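/- Let $d\ge 2$. On $\mathbb C^d\otimes\mathbb C^d$ (Alice, Bob) let $V(\varphi\otimes\psi)=\psi\otimes\varphi$ be the flip and, for real $\eta$, let $$W_d^\eta=\frac{d-1+\eta}{d-1}\,\frac{I}{d^2}-\frac{\eta}{d-1}\,\frac{V}{d}.$$ **Definitions.** For an observable (Hermitian operator) $A$ of Alice, let $\lambda(A)$ be its set of eigenvalues, $\Pi_a^A$ the orthogonal projection onto the eigenspace of $a\in\lambda(A)$, and $\tilde\rho_a^A=\mathrm{Tr}_{\rm Alice}[W(\Pi_a^A\otimes I)]$ Bob's unnormalized conditional state. A set $\mathfrak M$ of observables admits a *local hidden state (LHS) model* for $W$ if there are a probability space $(\Xi,\mu)$, a measurable family of density matrices $(\rho_\xi)_{\xi\in\Xi}$ of Bob and, for every $A\in\mathfrak M$, measurable functions $\wp(a|A,\cdot)$, $a\in\lambda(A)$, forming a probability distribution in $a$ for almost every $\xi$, such that $\tilde\rho_a^A=\int\wp(a|A,\xi)\,\rho_\xi\,d\mu(\xi)$ for all $A\in\mathfrak M$ and $a\in\lambda(A)$. The state $W$ is *steerable by Alice* if some set of observables $\mathfrak M$ admits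 no LHS model. It is *Bell-nonlocal* if for some sets $\mathfrak M,\mathfrak N$ of observables of Alice and Bob there is no local hidden variable model, i.e. no representation $\mathrm{Tr}[(\Pi_a^A\otimes\Pi_b^B)W]=\int\wp(a|A,\xi)\,\wp(b|B,\xi)\,d\mu(\xi)$ for all $A\in\mathfrak M$, $B\in\mathfrak N$, $a\in\lambda(A)$, $b\in\lambda(B)$. Let $\mu_H$ be the unitarily invariant (Haar) probability measure on unit vectors $\psi\in\mathbb C^d$. For an orthonormal basis $A=(|a\rangle)_{a=1}^d$ let Werner's response function be $\wp_{\rm W}(a|A,\psi)=1$ if $|\langle\psi|a\rangle|\le|\langle\psi|a'\rangle|$ for all $a'\ne a$, and $0$ otherwise (a probability distribution in $a$ for almost every $\psi$). **Theorem.** 1. $W_d^\eta$ is a density matrix iff $-\frac{d-1}{d+1}\le\eta\le 1$. 2. For every such $\eta$: $W_d^\eta$ is steerable by Alice iff $\eta>1-\frac1d$; that is, $\eta_{\rm steer}=1-\frac1d$. 3. For every such $\eta$ with $\eta\le 1-\frac1d$: the Haar-random pure states $|\psi\rangle\langle\psi|$, $\psi\sim\mu_H$, are the hidden states of an LHS model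 of $W_d^\eta$ for all observables of Alice. On rank-one projective measurements $A=(|a\rangle)_a$ the response function can be taken as the mixture $t\,\wp_{\rm W}(a|A,\psi)+(1-t)\,|\langle\psi|a\rangle|^2$ with some $t\in[0,1]$ that depends only on $d$ and $\eta$. Moreover $W_d^\eta$ is not Bell-nonlocal, so $\eta_{\rm steer}$ equals Werner's lower bound $1-\frac1d$ on $\eta_{\rm Bell}$. 4. For $\eta=1-\frac1d$ Werner's response function itself gives an LHS model: $\mathrm{Tr}_{\rm Alice}[W_d^\eta(|a\rangle\langle a|\otimes I)]=\int|\psi\rangle\langle\psi|\,\wp_{\rm W}(a|A,\psi)\,d\mu_H(\psi)$ for every orthonormal basis $A$ and every $a$. 5. For every orthonormal basis $A=(|a\rangle)_a$ and all measurable $\wp(a|A,\cdot)$ forming a probability distribution in $a$ for almost every $\psi$, $$\frac1d\sum_{a}\langle a|\Big(\int|\psi\rangle\langle\psi|\,\wp(a|A,\psi)\,d\mu_H(\psi)\Big)|a\rangle\ \ge\ \frac1{d^3},$$ and for $\wp=\wp_{\rm W}$ each of the $d$ terms $\langle a|\cdots|a\rangle$ equals $\frac1{d^3}$. -/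

import Mathlib

open MeasureTheory Matrix
open scoped Kronecker ComplexOrder

universe u

noncomputable section

namespace Steering

/-! ### Observables, states and conditional states (finite dimension) -/

/-- An observable on `ℂ^ι`: a Hermitian operator. -/
abbrev Observable (ι : Type) : Type := {A : Matrix ι ι ℂ // A.IsHermitian}

/-- A (positive, normalized) quantum state. -/
def IsDensityMatrix {ι : Type} [Fintype ι] (ρ : Matrix ι ι ℂ) : Prop :=
  ρ.PosSemidef ∧ ρ.trace = 1

/-- The set of possible results of a measurement of `A`: its distinct eigenvalues. -/
def Observable.outcomes {ι : Type} [Fintype ι] [DecidableEq ι] (A : Observable ι) : Finset ℝ :=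
  Finset.univ.image A.2.eigenvalues

/-- The projector for the result `a` of `A`: the orthogonal projection of `ℂ^ι` onto the
eigenspace of `A` for `a`, as a matrix. -/
def Observable.projector {ι : Type} [Fintype ι] [DecidableEq ι] (A : Observable ι) (a : ℝ) :
    Matrix ι ι ℂ :=
  Matrix.toEuclideanLin.symm
    ((Module.End.eigenspace (Matrix.toEuclideanLin A.1) (a : ℂ)).starProjection :
      EuclideanSpace ℂ ι →ₗ[ℂ] EuclideanSpace ℂ ι)

/-- Partial trace over the first (Alice's) factor. -/
def partialTraceAlice {ι κ : Type} [Fintype ι] (X : Matrix (ι × κ) (ι × κ) ℂ) : Matrix κ κ ℂ :=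
  Matrix.of fun j j' => ∑ i, X (i, j) (i, j')

/-- Bob's unnormalized state, given that Alice found the result with projector `P`. -/
def condState {ι κ : Type} [Fintype ι] [Fintype κ] [DecidableEq κ]
    (W : Matrix (ι × κ) (ι × κ) ℂ) (P : Matrix ι ι ℂ) : Matrix κ κ ℂ :=
  partialTraceAlice (W * (P ⊗ₖ (1 : Matrix κ κ ℂ)))

/-! ### Local hidden states, steering, Bell nonlocality -/

/-- `p a ξ` is a probability distribution of results `a ∈ s`, depending measurably on the hidden
variable `ξ` (it has to be positive and normalized for `μ`-almost every `ξ`). -/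
def IsResponse {Ξ : Type u} [MeasurableSpace Ξ] {α : Type} (μ : Measure Ξ) (s : Finset α)
    (p : α → Ξ → ℝ) : Prop :=
  (∀ a ∈ s, Measurable (p a)) ∧ ∀ᵐ ξ ∂μ, (∀ a ∈ s, 0 ≤ p a ξ) ∧ ∑ a ∈ s, p a ξ = 1

/-- The operator `∫ p(ξ) ρ_ξ dμ(ξ)`, computed entry by entry. -/
def ensembleAverage {Ξ : Type u} [MeasurableSpace Ξ] {κ : Type} (μ : Measure Ξ)
    (ρ : Ξ → Matrix κ κ ℂ) (p : Ξ → ℝ) : Matrix κ κ ℂ :=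
  Matrix.of fun i j => ∫ ξ, (p ξ : ℂ) * ρ ξ i j ∂μ

/-- `ξ ↦ ρ_ξ`, with `ξ` distributed according to `μ`, is an ensemble of quantum states. -/
structure IsEnsemble {Ξ : Type u} [MeasurableSpace Ξ] {κ : Type} [Fintype κ] (μ : Measure Ξ)
    (ρ : Ξ → Matrix κ κ ℂ) : Prop where
  prob : IsProbabilityMeasure μ
  meas : ∀ i j, Measurable fun ξ => ρ ξ i j
  state : ∀ ξ, IsDensityMatrix (ρ ξ)

/-- The ensemble `(μ, ρ)` of local hidden states for Bob reproduces all the conditional states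
that Alice can prepare by the measurements in `M`. -/
def IsLHSEnsembleFor {Ξ : Type u} [MeasurableSpace Ξ] {ι κ : Type} [Fintype ι] [DecidableEq ι]
    [Fintype κ] [DecidableEq κ] (M : Set (Observable ι)) (W : Matrix (ι × κ) (ι × κ) ℂ)
    (μ : Measure Ξ) (ρ : Ξ → Matrix κ κ ℂ) : Prop :=
  IsEnsemble μ ρ ∧ ∀ A ∈ M, ∃ p : ℝ → Ξ → ℝ, IsResponse μ A.outcomes p ∧
    ∀ a ∈ A.outcomes, condState W (A.projector a) = ensembleAverage μ ρ (p a)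

/-- Alice's measurement strategy `M` on the state `W` exhibits steering: no local hidden state
model accounts for it. -/
def ExhibitsSteering {ι κ : Type} [Fintype ι] [DecidableEq ι] [Fintype κ] [DecidableEq κ]
    (M : Set (Observable ι)) (W : Matrix (ι × κ) (ι × κ) ℂ) : Prop :=
  ¬ ∃ (Ξ : Type u) (_ : MeasurableSpace Ξ) (μ : Measure Ξ) (ρ : Ξ → Matrix κ κ ℂ),
    IsLHSEnsembleFor M W μ ρ

/-- `W` is steerable by Alice. -/
def Steerable {ι κ : Type} [Fintype ι] [DecidableEq ι] [Fintype κ] [DecidableEq κ]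
    (W : Matrix (ι × κ) (ι × κ) ℂ) : Prop :=
  ∃ M : Set (Observable ι), ExhibitsSteering.{u} M W

/-- There is a local hidden variable model for the joint results of the measurements in `M` by
Alice and in `N` by Bob. -/
def HasLHVModel {ι κ : Type} [Fintype ι] [DecidableEq ι] [Fintype κ] [DecidableEq κ]
    (M : Set (Observable ι)) (N : Set (Observable κ)) (W : Matrix (ι × κ) (ι × κ) ℂ) : Prop :=
  ∃ (Ξ : Type u) (_ : MeasurableSpace Ξ) (μ : Measure Ξ)
    (p : Observable ι → ℝ → Ξ → ℝ) (q : Observable κ → ℝ → Ξ → ℝ),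
    IsProbabilityMeasure μ ∧
    (∀ A ∈ M, IsResponse μ A.outcomes (p A)) ∧ (∀ B ∈ N, IsResponse μ B.outcomes (q B)) ∧
    ∀ A ∈ M, ∀ B ∈ N, ∀ a ∈ A.outcomes, ∀ b ∈ B.outcomes,
      ((A.projector a ⊗ₖ B.projector b) * W).trace = ((∫ ξ, p A a ξ * q B b ξ ∂μ : ℝ) : ℂ)

/-- `W` is Bell-nonlocal (for projective measurements). -/
def BellNonlocal {ι κ : Type} [Fintype ι] [DecidableEq ι] [Fintype κ] [DecidableEq κ]
    (W : Matrix (ι × κ) (ι × κ) ℂ) : Prop :=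
  ∃ (M : Set (Observable ι)) (N : Set (Observable κ)), ¬ HasLHVModel.{u} M N W

/-! ### Werner states -/

/-- The flip operator `V (φ ⊗ ψ) = ψ ⊗ φ` on `ℂ^d ⊗ ℂ^d`. -/
def flip (d : ℕ) : Matrix (Fin d × Fin d) (Fin d × Fin d) ℂ :=
  Matrix.of fun x y => if x.1 = y.2 ∧ x.2 = y.1 then 1 else 0

/-- The Werner state `W_d^η`. -/
def wernerState (d : ℕ) (η : ℝ) : Matrix (Fin d × Fin d) (Fin d × Fin d) ℂ :=
  ((((d - 1 + η) / (d - 1)) * (1 / d ^ 2) : ℝ) : ℂ) • 1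
    - (((η / (d - 1)) * (1 / d) : ℝ) : ℂ) • flip d

/-! ### Haar-random pure states -/

/-- Unit vectors of `ℂ^d`. -/
abbrev PureState (d : ℕ) : Type := Metric.sphere (0 : EuclideanSpace ℂ (Fin d)) 1

/-- The operator `|v⟩⟨v|`. -/
def ketBra {d : ℕ} (v : EuclideanSpace ℂ (Fin d)) : Matrix (Fin d) (Fin d) ℂ :=
  Matrix.of fun i j => v i * star (v j)

/-- Lebesgue measure on `ℂ^d`. -/
def lebesgue (d : ℕ) : Measure (EuclideanSpace ℂ (Fin d)) :=
  (volume : Measure (Fin d → ℂ)).map (WithLp.toLp 2)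

/-- The Haar (unitarily invariant, normalized) measure on the pure states of `ℂ^d`: the
normalized surface measure of the unit sphere. -/
def haarPure (d : ℕ) : Measure (PureState d) :=
  ((lebesgue d).toSphere Set.univ)⁻¹ • (lebesgue d).toSphere

/-- Werner's response function: the result `a` is given iff `|⟨ψ|a⟩|` is minimal. -/
def wernerResponse {d : ℕ} (b : OrthonormalBasis (Fin d) ℂ (EuclideanSpace ℂ (Fin d)))
    (a : Fin d) (ψ : PureState d) : ℝ :=
  open Classical in
  if ∀ a', a' ≠ a → ‖inner ℂ ψ.1 (b a)‖ ≤ ‖inner ℂ ψ.1 (b a')‖ then 1 else 0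

/-- The quantum mechanical (Born) probability `|⟨ψ|a⟩|²`. -/
def bornResponse {d : ℕ} (b : OrthonormalBasis (Fin d) ℂ (EuclideanSpace ℂ (Fin d)))
    (a : Fin d) (ψ : PureState d) : ℝ :=
  ‖inner ℂ ψ.1 (b a)‖ ^ 2

/-- The Haar-random pure states and the response functions `p b`, one for each rank-one
projective measurement (orthonormal basis) `b` of Alice, form a local hidden state model of the
bipartite state `W`. -/
def IsHaarLHSModel {d : ℕ} (W : Matrix (Fin d × Fin d) (Fin d × Fin d) ℂ)
    (p : OrthonormalBasis (Fin d) ℂ (EuclideanSpace ℂ (Fin d)) → Fin d → PureState d → ℝ) : Prop :=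
  ∀ b, IsResponse (haarPure d) Finset.univ (p b) ∧
    ∀ a, condState W (ketBra (b a)) = ensembleAverage (haarPure d) (fun ψ => ketBra ψ.1) (p b a)

/-- The number `⟨v|X|v⟩` (for Hermitian `X`). -/
def expectation {d : ℕ} (X : Matrix (Fin d) (Fin d) ℂ) (v : EuclideanSpace ℂ (Fin d)) : ℝ :=
  (inner ℂ v (Matrix.toEuclideanLin X v)).re

end Steering

end

/-! If Alice finds the outcome `P`, Bob's unnormalized state is `α (Tr P) I - β P`, where `α` and
`β` are the coefficients of `I` and `-V` in the Werner state. For a basis measurement each number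
`⟨a|ρ̃_a|a⟩` is therefore `α - β = (1-η)/d²`, and this single number decides the matter.

Existence of models. Let the response to a basis measurement depend only on the moduli of the
amplitudes of `ψ` in that basis, and treat all outcomes alike. The Haar average of `|ψ⟩⟨ψ|` against
it is then diagonal (sign flips of coordinates), constant on the diagonal away from `a`
(permutations), and has trace `1/d`. Such an operator is fixed by its `a`-th diagonal entry, so a
model arises as soon as `∫ |ψ_a|² R_a = (1-η)/d²` (`isHaarLHSModel_of_isSymmetricResponse`).
Werner's response gives `1/d³`, the Born rule gives `2/(d(d+1))`. These are the required values at
`η = 1 - 1/d` and at `η = -(d-1)/(d+1)`, so mixtures of the two responses cover exactly the range in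
between. Degenerate observables follow by coarse-graining an eigenbasis, and Bell locality by
letting Bob answer with the quantum probabilities of his hidden state.

Bound. Whatever Alice's response, `∑ₐ ⟨a|ρ̃_a|a⟩ ≥ ∫ minₐ ⟨a|ρ_ξ|a⟩ dμ`
(`integral_iInf_le_sum_expectation`). Average this over a Haar-random basis. The minimum is concave
in `ρ_ξ`, so each hidden state contributes at least what a pure state does, namely the Haar mean
`1/d²` of `minₐ |ψ_a|²` (`le_integral_iInf_expectation`). Hence `(1-η)/d ≥ 1/d²`, that is, `η ≤ 1 -
1/d`, for every ensemble.

The moments come from Gaussian integrals on `ℂ^d`, where coordinates are independent: for a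
homogeneous function, Gaussian and spherical averages differ by a factor depending only on `d` and
the degree. -/

namespace Steering

/-! ### Conditional states and the flip operator -/

theorem condState_one {ι κ : Type} [Fintype ι] [DecidableEq ι] [Fintype κ] [DecidableEq κ]
    (P : Matrix ι ι ℂ) :
    condState (1 : Matrix (ι × κ) (ι × κ) ℂ) P = P.trace • (1 : Matrix κ κ ℂ) := by
  ext j j'
  simp [condState, partialTraceAlice, Matrix.trace, Finset.sum_mul, Matrix.kroneckerMap_apply]

theorem condState_flip (d : ℕ) (P : Matrix (Fin d) (Fin d) ℂ) : condState (flip d) P = P := by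
  ext j j'
  simp [condState, partialTraceAlice, flip, Matrix.mul_apply, Fintype.sum_prod_type,
    Matrix.kroneckerMap_apply, Matrix.one_apply, ite_and]

theorem condState_sub {ι κ : Type} [Fintype ι] [Fintype κ] [DecidableEq κ]
    (W₁ W₂ : Matrix (ι × κ) (ι × κ) ℂ) (P : Matrix ι ι ℂ) :
    condState (W₁ - W₂) P = condState W₁ P - condState W₂ P := by
  ext j j'
  simp [condState, partialTraceAlice, Matrix.sub_mul]

theorem condState_smul {ι κ : Type} [Fintype ι] [Fintype κ] [DecidableEq κ] (c : ℂ)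
    (W : Matrix (ι × κ) (ι × κ) ℂ) (P : Matrix ι ι ℂ) :
    condState (c • W) P = c • condState W P := by
  ext j j'
  simp [condState, partialTraceAlice, Finset.mul_sum]

theorem condState_sum {ι κ α : Type} [Fintype ι] [Fintype κ] [DecidableEq κ]
    (W : Matrix (ι × κ) (ι × κ) ℂ) (s : Finset α) (P : α → Matrix ι ι ℂ) :
    condState W (∑ x ∈ s, P x) = ∑ x ∈ s, condState W (P x) := by
  ext j j'
  simp only [condState, partialTraceAlice, Matrix.mul_apply, Matrix.kroneckerMap_apply,
    Matrix.sum_apply, Matrix.of_apply, Finset.sum_mul, Finset.mul_sum]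
  exact (Finset.sum_congr rfl fun i _ => Finset.sum_comm).trans Finset.sum_comm

/-- The conditional states of the Werner state. -/
theorem condState_wernerState (d : ℕ) (η : ℝ) (P : Matrix (Fin d) (Fin d) ℂ) :
    condState (wernerState d η) P =
      ((((d - 1 + η) / (d - 1)) * (1 / d ^ 2) : ℝ) : ℂ) • (P.trace • (1 : Matrix _ _ ℂ))
      - (((η / (d - 1)) * (1 / d) : ℝ) : ℂ) • P := by
  rw [wernerState, condState_sub, condState_smul, condState_smul, condState_one, condState_flip]

/-- Joint statistics involve Alice's outcome only through Bob's conditional state; this is what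
converts hidden states into hidden variables. The operator splits as `(P ⊗ 1)(1 ⊗ Q)`, and cyclicity
of the trace does the rest. -/
theorem trace_kronecker_mul {ι κ : Type} [Fintype ι] [DecidableEq ι] [Fintype κ] [DecidableEq κ]
    (W : Matrix (ι × κ) (ι × κ) ℂ) (P : Matrix ι ι ℂ) (Q : Matrix κ κ ℂ) :
    ((P ⊗ₖ Q) * W).trace = (Q * condState W P).trace := by
  have h : P ⊗ₖ Q = (P ⊗ₖ (1 : Matrix κ κ ℂ)) * (Matrix.of fun x y : ι × κ =>
      if x.1 = y.1 then Q x.2 y.2 else 0) := by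
    ext x y
    rw [Matrix.mul_apply, Fintype.sum_prod_type, Finset.sum_eq_single y.1]
    · simp [Matrix.one_apply]
    · intro b _ hb
      simp [hb]
    · simp
  rw [h, Matrix.mul_assoc, Matrix.trace_mul_comm, Matrix.mul_assoc]
  simp only [condState, partialTraceAlice, Matrix.trace, Matrix.diag_apply, Fintype.sum_prod_type,
    Matrix.mul_apply (M := Matrix.of _), Matrix.mul_apply (M := Q), Matrix.of_apply, ite_mul,
    zero_mul]
  rw [Finset.sum_comm]
  refine Finset.sum_congr rfl fun k _ => ?_
  refine (Finset.sum_congr rfl fun i _ => Finset.sum_comm).trans ?_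
  rw [Finset.sum_comm]
  refine Finset.sum_congr rfl fun l _ => ?_
  rw [Finset.mul_sum]
  refine Finset.sum_congr rfl fun i _ => ?_
  exact (Finset.sum_ite_eq _ _ _).trans (if_pos (Finset.mem_univ _))

theorem flip_mul_flip (d : ℕ) : flip d * flip d = 1 := by
  ext x y
  rcases x with ⟨a, b⟩
  rcases y with ⟨a', b'⟩
  simp [flip, Matrix.mul_apply, Fintype.sum_prod_type, Matrix.one_apply, ite_and]

theorem flip_isHermitian (d : ℕ) : (flip d).IsHermitian := by
  ext x y
  simp only [flip, Matrix.conjTranspose_apply, Matrix.of_apply]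
  rw [apply_ite star, star_one, star_zero]
  exact if_congr ⟨fun h => ⟨h.2.symm, h.1.symm⟩, fun h => ⟨h.2.symm, h.1.symm⟩⟩ rfl rfl

/-- Since `V² = 1`, the Hermitian operator `1 ± V` squares to twice itself, so it is half of a
square. -/
theorem posSemidef_one_add_flip (d : ℕ) (c : ℝ) (hc : c ^ 2 = 1) :
    (1 + (c : ℂ) • flip d).PosSemidef := by
  have hc' : (c : ℂ) * c = 1 := by rw [← sq]; exact_mod_cast hc
  have hH : (1 + (c : ℂ) • flip d)ᴴ = 1 + (c : ℂ) • flip d := by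
    rw [Matrix.conjTranspose_add, Matrix.conjTranspose_smul, (flip_isHermitian d).eq]
    simp
  have h : 1 + (c : ℂ) • flip d =
      (1 / 2 : ℝ) • ((1 + (c : ℂ) • flip d)ᴴ * (1 + (c : ℂ) • flip d)) := by
    rw [hH, Matrix.mul_add, Matrix.add_mul, Matrix.add_mul, Matrix.smul_mul, Matrix.mul_smul,
      Matrix.smul_mul, Matrix.mul_smul (flip d), flip_mul_flip, smul_smul, hc']
    simp only [Matrix.mul_one, Matrix.one_mul, one_smul]
    module
  rw [h]
  exact (Matrix.posSemidef_conjTranspose_mul_self _).smul (by norm_num)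

theorem trace_flip (d : ℕ) : (flip d).trace = d := by
  simp only [flip, Matrix.trace, Matrix.diag_apply, Matrix.of_apply, Fintype.sum_prod_type]
  have h : ∀ x y : Fin d, (x = y ∧ y = x) ↔ x = y := fun x y => ⟨And.left, fun h => ⟨h, h.symm⟩⟩
  simp [h]

theorem trace_wernerState (d : ℕ) (hd : 2 ≤ d) (η : ℝ) : (wernerState d η).trace = 1 := by
  have h1 : (d : ℂ) ≠ 0 := by exact_mod_cast (by omega : d ≠ 0)
  have h2 : (d : ℂ) - 1 ≠ 0 := by
    rw [sub_ne_zero]; exact_mod_cast (by omega : d ≠ 1)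
  rw [wernerState, Matrix.trace_sub, Matrix.trace_smul, Matrix.trace_smul, trace_flip,
    Matrix.trace_one]
  simp only [Fintype.card_prod, Fintype.card_fin, smul_eq_mul]
  push_cast
  field_simp
  ring

/-- The parameter range of the Werner states. -/
theorem isDensityMatrix_wernerState_iff (d : ℕ) (hd : 2 ≤ d) (η : ℝ) :
    IsDensityMatrix (wernerState d η) ↔ -((d : ℝ) - 1) / (d + 1) ≤ η ∧ η ≤ 1 := by
  have hd' : (2 : ℝ) ≤ d := by exact_mod_cast hd
  have h0 : (0 : ℝ) < d := by linarith
  have h1 : (0 : ℝ) < d - 1 := by linarith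
  have h2 : (0 : ℝ) < d + 1 := by linarith
  set α : ℝ := ((d - 1 + η) / (d - 1)) * (1 / d ^ 2) with hα
  set β : ℝ := (η / (d - 1)) * (1 / d) with hβ
  have hW : wernerState d η = (α : ℂ) • 1 - (β : ℂ) • flip d := rfl
  have hsub : α - β = (1 - η) / d ^ 2 := by
    rw [hα, hβ]; field_simp; ring
  have hadd : α + β = (d + 1) * (η - (-((d : ℝ) - 1) / (d + 1))) / ((d - 1) * d ^ 2) := by
    rw [hα, hβ]; field_simp; ring
  have e1 : 0 ≤ α - β ↔ η ≤ 1 := by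
    rw [hsub]
    constructor
    · intro h
      by_contra! h'
      have : (1 - η) / (d : ℝ) ^ 2 < 0 := div_neg_of_neg_of_pos (by linarith) (by positivity)
      linarith
    · intro h
      have : 0 ≤ 1 - η := by linarith
      positivity
  have e2 : 0 ≤ α + β ↔ -((d : ℝ) - 1) / (d + 1) ≤ η := by
    rw [hadd]
    constructor
    · intro h
      by_contra! h'
      have : (d + 1) * (η - (-((d : ℝ) - 1) / (d + 1))) / ((d - 1) * d ^ 2) < 0 :=
        div_neg_of_neg_of_pos (mul_neg_of_pos_of_neg h2 (by linarith)) (by positivity)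
      linarith
    · intro h
      have : 0 ≤ η - (-((d : ℝ) - 1) / (d + 1)) := by linarith
      positivity
  rw [IsDensityMatrix, and_iff_left (trace_wernerState d hd η), ← e1, ← e2]
  constructor
  · intro h
    let i0 : Fin d := ⟨0, by omega⟩
    let i1 : Fin d := ⟨1, by omega⟩
    have hne : i0 ≠ i1 := by simp [i0, i1]
    have hne' : i1 ≠ i0 := hne.symm
    constructor
    -- An antisymmetric vector, on which `V = -1`: positivity there says `α + β ≥ 0`.
    · have := h.dotProduct_mulVec_nonneg (Pi.single (i0, i1) 1 - Pi.single (i1, i0) 1)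
      simp only [star_sub, Matrix.mulVec_sub, dotProduct_sub, sub_dotProduct, ← Pi.single_star,
        star_one, Matrix.mulVec_single_one, single_one_dotProduct, Matrix.col_apply] at this
      simp [hW, flip, hne, hne'] at this
      have h' : ((-β : ℝ) : ℂ) ≤ ((α + β + α : ℝ) : ℂ) := by
        push_cast
        exact this
      rw [Complex.real_le_real] at h'
      linarith
    -- The product vector `e₀ ⊗ e₀` is symmetric, so `V = 1` on it and positivity says `α - β ≥ 0`.
    · have := h.diag_nonneg (i := (i0, i0))
      simp [hW, flip] at this
      have h' : (0 : ℂ) ≤ ((α - β : ℝ) : ℂ) := by push_cast; simpa using this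
      exact Complex.zero_le_real.1 h'
  · rintro ⟨ha, hs⟩
    -- Spectral decomposition along the symmetric and antisymmetric projections `(1 ± V)/2`.
    have : wernerState d η = ((α - β) / 2) • (1 + ((1 : ℝ) : ℂ) • flip d)
        + ((α + β) / 2) • (1 + ((-1 : ℝ) : ℂ) • flip d) := by
      rw [hW]
      ext x y
      simp
      ring
    rw [this]
    exact ((posSemidef_one_add_flip d 1 (by norm_num)).smul (by linarith)).add
      ((posSemidef_one_add_flip d (-1) (by norm_num)).smul (by linarith))

/-! ### Rank-one operators and matrix elements -/

theorem toEuclideanLin_ketBra {d : ℕ} (v x : EuclideanSpace ℂ (Fin d)) :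
    Matrix.toEuclideanLin (ketBra v) x = inner ℂ v x • v := by
  ext i
  simp [Matrix.toLpLin_apply, ketBra, Matrix.mulVec, dotProduct, PiLp.inner_apply,
    Finset.sum_mul]
  refine Finset.sum_congr rfl fun j _ => by ring

theorem trace_ketBra {d : ℕ} (v : EuclideanSpace ℂ (Fin d)) :
    (ketBra v).trace = ((‖v‖ ^ 2 : ℝ) : ℂ) := by
  rw [EuclideanSpace.norm_sq_eq]
  push_cast
  simp [ketBra, Matrix.trace, Complex.mul_conj, Complex.normSq_eq_norm_sq]

theorem trace_ketBra_mul {d : ℕ} (v : EuclideanSpace ℂ (Fin d)) (X : Matrix (Fin d) (Fin d) ℂ) :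
    (ketBra v * X).trace = inner ℂ v (Matrix.toEuclideanLin X v) := by
  simp only [Matrix.trace, Matrix.diag_apply, Matrix.mul_apply, ketBra, Matrix.of_apply,
    PiLp.inner_apply, Matrix.toLpLin_apply, Matrix.mulVec, dotProduct, RCLike.inner_apply,
    Finset.sum_mul]
  rw [Finset.sum_comm]
  refine Finset.sum_congr rfl fun i _ => Finset.sum_congr rfl fun j _ => ?_
  simp only [RCLike.star_def]
  ring

theorem inner_toEuclideanLin_eq_sum {d : ℕ} (X : Matrix (Fin d) (Fin d) ℂ)
    (v w : EuclideanSpace ℂ (Fin d)) :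
    inner ℂ v (Matrix.toEuclideanLin X w) = ∑ i, ∑ j, star (v i) * X i j * w j := by
  simp only [PiLp.inner_apply, Matrix.toLpLin_apply, Matrix.mulVec, dotProduct,
    RCLike.inner_apply, Finset.sum_mul]
  refine Finset.sum_congr rfl fun i _ => Finset.sum_congr rfl fun j _ => ?_
  simp only [RCLike.star_def]
  ring

/-- Matrices are determined by their entries in an orthonormal basis. -/
theorem matrix_ext_basis {d : ℕ} (b : OrthonormalBasis (Fin d) ℂ (EuclideanSpace ℂ (Fin d)))
    {X Y : Matrix (Fin d) (Fin d) ℂ}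
    (h : ∀ i j, inner ℂ (b i) (Matrix.toEuclideanLin X (b j)) =
      inner ℂ (b i) (Matrix.toEuclideanLin Y (b j))) : X = Y := by
  apply Matrix.toEuclideanLin.injective
  refine b.toBasis.ext fun j => ?_
  rw [OrthonormalBasis.coe_toBasis]
  refine b.repr.injective (PiLp.ext fun i => ?_)
  rw [b.repr_apply_apply, b.repr_apply_apply]
  exact h i j

/-! ### Outcomes and projectors from an arbitrary eigenbasis -/

/-- The right-hand side does not mention the basis, so any two eigenbases yield the same set of
eigenvalues. Expanding an eigenvector in `b`, every coefficient with `e i ≠ a` vanishes. -/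
theorem eigenvector_iff {d : ℕ} (A : Matrix (Fin d) (Fin d) ℂ)
    (b : OrthonormalBasis (Fin d) ℂ (EuclideanSpace ℂ (Fin d))) (e : Fin d → ℝ)
    (h : ∀ i, Matrix.toEuclideanLin A (b i) = (e i : ℂ) • b i) (a : ℝ) :
    (∃ i, e i = a) ↔
      ∃ v : EuclideanSpace ℂ (Fin d), v ≠ 0 ∧ Matrix.toEuclideanLin A v = (a : ℂ) • v := by
  constructor
  · rintro ⟨i, rfl⟩
    exact ⟨b i, b.orthonormal.ne_zero i, h i⟩
  · rintro ⟨v, hv, hav⟩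
    by_contra! hne
    apply hv
    refine b.repr.injective (PiLp.ext fun i => ?_)
    rw [b.repr_apply_apply, b.repr_apply_apply, inner_zero_right]
    have h1 : Matrix.toEuclideanLin A v = ∑ j, (inner ℂ (b j) v * e j) • b j := by
      conv_lhs => rw [← b.sum_repr' v]
      rw [map_sum]
      refine Finset.sum_congr rfl fun j _ => ?_
      rw [map_smul, h, smul_smul]
    have h2 : inner ℂ (b i) (Matrix.toEuclideanLin A v) = inner ℂ (b i) v * e i := by
      rw [h1, b.orthonormal.inner_right_fintype]
    rw [hav, inner_smul_right] at h2
    have h3 : ((a : ℂ) - e i) * inner ℂ (b i) v = 0 := by rw [sub_mul, h2]; ring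
    rcases mul_eq_zero.1 h3 with h4 | h4
    · exact absurd (by exact_mod_cast (sub_eq_zero.1 h4).symm) (hne i)
    · exact h4

theorem toEuclideanLin_eigenvectorBasis {d : ℕ} (A : Observable (Fin d)) (i : Fin d) :
    Matrix.toEuclideanLin A.1 (A.2.eigenvectorBasis i) =
      (A.2.eigenvalues i : ℂ) • A.2.eigenvectorBasis i := by
  have := A.2.mulVec_eigenvectorBasis i
  ext k
  rw [Matrix.toLpLin_apply]
  have := congrFun this k
  simpa using this

theorem outcomes_eq_image {d : ℕ} (A : Observable (Fin d))
    (b : OrthonormalBasis (Fin d) ℂ (EuclideanSpace ℂ (Fin d))) (e : Fin d → ℝ)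
    (h : ∀ i, Matrix.toEuclideanLin A.1 (b i) = (e i : ℂ) • b i) :
    A.outcomes = Finset.univ.image e := by
  ext a
  simp only [Observable.outcomes, Finset.mem_image, Finset.mem_univ, true_and]
  rw [eigenvector_iff A.1 b e h a,
    eigenvector_iff A.1 _ _ (toEuclideanLin_eigenvectorBasis A) a]

/-- Both sides are compared on `b`: a basis vector with eigenvalue `a` lies in the eigenspace, and
any other is orthogonal to it because `A` is symmetric. -/
theorem projector_eq_sum {d : ℕ} (A : Observable (Fin d))
    (b : OrthonormalBasis (Fin d) ℂ (EuclideanSpace ℂ (Fin d))) (e : Fin d → ℝ)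
    (h : ∀ i, Matrix.toEuclideanLin A.1 (b i) = (e i : ℂ) • b i) (a : ℝ) :
    A.projector a = ∑ i with e i = a, ketBra (b i) := by
  rw [Observable.projector, LinearEquiv.symm_apply_eq]
  refine b.toBasis.ext fun j => ?_
  rw [OrthonormalBasis.coe_toBasis, map_sum, LinearMap.sum_apply]
  simp only [toEuclideanLin_ketBra, orthonormal_iff_ite.1 b.orthonormal, ite_smul, one_smul,
    zero_smul, Finset.sum_ite_eq', Finset.mem_filter, Finset.mem_univ, true_and]
  set K := Module.End.eigenspace (Matrix.toEuclideanLin A.1) (a : ℂ)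
  split_ifs with hj
  · refine Submodule.starProjection_eq_self_iff.2 ?_
    rw [Module.End.mem_eigenspace_iff, h, hj]
  · refine (Submodule.eq_starProjection_of_mem_of_inner_eq_zero K.zero_mem fun w hw => ?_)
    rw [Module.End.mem_eigenspace_iff] at hw
    rw [sub_zero]
    have h1 := Matrix.isSymmetric_toEuclideanLin_iff.2 A.2 (b j) w
    rw [h, hw, inner_smul_left, inner_smul_right, Complex.conj_ofReal] at h1
    have h3 : ((e j : ℂ) - a) * inner ℂ (b j) w = 0 := by rw [sub_mul, h1]; ring
    rcases mul_eq_zero.1 h3 with h4 | h4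
    · exact absurd (by exact_mod_cast sub_eq_zero.1 h4) hj
    · exact h4

/-- The observable with eigenbasis `b` and eigenvalues `e`. -/
noncomputable def basisObservable {d : ℕ}
    (b : OrthonormalBasis (Fin d) ℂ (EuclideanSpace ℂ (Fin d))) (e : Fin d → ℝ) :
    Observable (Fin d) :=
  ⟨∑ i, (e i : ℂ) • ketBra (b i), by
    rw [Matrix.IsHermitian, Matrix.conjTranspose_sum]
    refine Finset.sum_congr rfl fun i _ => ?_
    rw [Matrix.conjTranspose_smul]
    ext j k
    simp [ketBra, mul_comm]⟩

theorem toEuclideanLin_basisObservable {d : ℕ}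
    (b : OrthonormalBasis (Fin d) ℂ (EuclideanSpace ℂ (Fin d))) (e : Fin d → ℝ) (i : Fin d) :
    Matrix.toEuclideanLin (basisObservable b e).1 (b i) = (e i : ℂ) • b i := by
  simp only [basisObservable, map_sum, LinearMap.sum_apply, map_smul, LinearMap.smul_apply,
    toEuclideanLin_ketBra, orthonormal_iff_ite.1 b.orthonormal, ite_smul, one_smul, zero_smul,
    smul_ite, smul_zero, Finset.sum_ite_eq', Finset.mem_univ, if_true]

/-! ### Polar coordinates and Gaussian versus spherical averages -/

instance isAddHaarMeasure_lebesgue (d : ℕ) : (lebesgue d).IsAddHaarMeasure := by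
  unfold lebesgue
  exact (PiLp.continuousLinearEquiv 2 ℂ (fun _ : Fin d => ℂ)).symm.isAddHaarMeasure_map volume

theorem integral_lebesgue {d : ℕ} (f : EuclideanSpace ℂ (Fin d) → ℝ) :
    ∫ z, f z ∂(lebesgue d) = ∫ x : Fin d → ℂ, f (WithLp.toLp 2 x) := by
  rw [lebesgue]
  exact (MeasurableEquiv.toLp 2 (Fin d → ℂ)).measurableEmbedding.integral_map f

/-- Integration of homogeneous functions against a radial weight in polar coordinates. -/
theorem integral_homogeneous_mul_norm {E : Type*} [NormedAddCommGroup E] [NormedSpace ℝ E]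
    [Nontrivial E] [MeasurableSpace E] [BorelSpace E] [FiniteDimensional ℝ E] (μ : Measure E)
    [μ.IsAddHaarMeasure] (m : ℕ) (f : E → ℝ) (g : ℝ → ℝ)
    (hf : ∀ r : ℝ, 0 < r → ∀ z, f (r • z) = r ^ m * f z) :
    ∫ z, f z * g ‖z‖ ∂μ = (∫ ψ, f ψ.1 ∂μ.toSphere) *
      ∫ r : Set.Ioi (0 : ℝ), r.1 ^ m * g r.1 ∂(Measure.volumeIoiPow (Module.finrank ℝ E - 1)) :=
  calc
    ∫ z, f z * g ‖z‖ ∂μ = ∫ z : ({(0)}ᶜ : Set E), f z.1 * g ‖z.1‖ ∂(μ.comap (↑)) := by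
      rw [integral_subtype_comap (measurableSet_singleton _).compl fun x ↦ f x * g ‖x‖,
        restrict_compl_singleton]
    _ = ∫ x, f x.1.1 * (x.2.1 ^ m * g x.2.1)
          ∂μ.toSphere.prod (.volumeIoiPow (Module.finrank ℝ E - 1)) := by
      rw [← μ.measurePreserving_homeomorphUnitSphereProd.integral_comp
        (Homeomorph.measurableEmbedding _)]
      refine integral_congr_ae (Filter.Eventually.of_forall fun z => ?_)
      have hz : 0 < ‖z.1‖ := norm_pos_iff.2 z.2
      -- Homogeneity pulls the value at `z` back to the unit vector `z/‖z‖`, separating the angular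
      -- from the radial variable.
      have h := hf ‖z.1‖ hz (‖z.1‖⁻¹ • z.1)
      rw [smul_inv_smul₀ hz.ne'] at h
      simp only [homeomorphUnitSphereProd_apply_snd_coe, homeomorphUnitSphereProd_apply_fst_coe]
      rw [h]
      ring
    _ = _ := integral_prod_mul (fun ψ : Metric.sphere (0 : E) 1 => f ψ.1)
      (fun r : Set.Ioi (0 : ℝ) => r.1 ^ m * g r.1)

instance isProbabilityMeasure_haarPure (d : ℕ) [NeZero d] :
    IsProbabilityMeasure (haarPure d) := by
  constructor
  rw [haarPure, Measure.smul_apply, smul_eq_mul]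
  refine ENNReal.inv_mul_cancel ?_ (measure_ne_top _ _)
  rw [Ne, Measure.measure_univ_eq_zero]
  exact Measure.toSphere_ne_zero _

/-- Gaussian integrals of homogeneous functions of degree `m` are proportional to spherical
averages. -/
theorem exists_gaussian_eq_haarPure (d : ℕ) [NeZero d] (m : ℕ) :
    ∃ C : ℝ, ∀ f : EuclideanSpace ℂ (Fin d) → ℝ,
      (∀ r : ℝ, 0 < r → ∀ z, f (r • z) = r ^ m * f z) →
      ∫ x : Fin d → ℂ, f (WithLp.toLp 2 x) * ∏ i, Real.exp (-‖x i‖ ^ 2) =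
        C * ∫ ψ, f ψ.1 ∂(haarPure d) := by
  have hne : ((lebesgue d).toSphere Set.univ).toReal ≠ 0 := by
    refine (ENNReal.toReal_pos ?_ (measure_ne_top _ _)).ne'
    rw [Ne, Measure.measure_univ_eq_zero]
    exact Measure.toSphere_ne_zero _
  refine ⟨((lebesgue d).toSphere Set.univ).toReal * ∫ r : Set.Ioi (0 : ℝ),
    r.1 ^ m * Real.exp (-r.1 ^ 2) ∂(Measure.volumeIoiPow
      (Module.finrank ℝ (EuclideanSpace ℂ (Fin d)) - 1)), fun f hf => ?_⟩
  have h := integral_homogeneous_mul_norm (lebesgue d) m f (fun r => Real.exp (-r ^ 2)) hf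
  rw [integral_lebesgue] at h
  have h2 : ∀ x : Fin d → ℂ, ∏ i, Real.exp (-‖x i‖ ^ 2) =
      Real.exp (-‖WithLp.toLp 2 x‖ ^ 2) := fun x => by
    rw [← Real.exp_sum, EuclideanSpace.norm_sq_eq, Finset.sum_neg_distrib]
  simp only [h2]
  rw [h, haarPure, integral_smul_measure, ENNReal.toReal_inv, smul_eq_mul]
  field_simp

/-! ### Gaussian integrals over `ℂ` -/

theorem integral_complex_norm (g : ℝ → ℝ) :
    ∫ z : ℂ, g ‖z‖ = 2 * Real.pi * ∫ r in Set.Ioi (0 : ℝ), r * g r := by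
  rw [integral_fun_norm_addHaar]
  simp [Complex.finrank_real_complex, Measure.real, mul_assoc]

theorem integral_Ioi_mul_exp_neg_sq (s : ℝ) (hs : 0 ≤ s) :
    ∫ r in Set.Ioi s, r * Real.exp (-r ^ 2) = Real.exp (-s ^ 2) / 2 := by
  have hd : ∀ r : ℝ, HasDerivAt (fun r : ℝ => -Real.exp (-r ^ 2) / 2) (r * Real.exp (-r ^ 2)) r := by
    intro r
    have h := (hasDerivAt_pow 2 r).fun_neg.exp.fun_neg.div_const 2
    refine h.congr_deriv ?_
    simp
    ring
  have hl : Filter.Tendsto (fun r : ℝ => -Real.exp (-r ^ 2) / 2) Filter.atTop (nhds 0) := by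
    have : Filter.Tendsto (fun r : ℝ => Real.exp (-r ^ 2)) Filter.atTop (nhds 0) :=
      Real.tendsto_exp_neg_atTop_nhds_zero.comp (Filter.tendsto_pow_atTop two_ne_zero)
    simpa using this.neg.div_const 2
  rw [integral_Ioi_of_hasDerivAt_of_nonneg' (fun r _ => hd r)
    (fun r hr => mul_nonneg (hs.trans (le_of_lt hr)) (Real.exp_pos _).le) hl]
  ring

theorem integral_complex_pow_mul_exp (m : ℕ) (b : ℝ) (hb : 0 < b) :
    ∫ z : ℂ, ‖z‖ ^ (2 * m) * Real.exp (-b * ‖z‖ ^ 2) = Real.pi * m.factorial / b ^ (m + 1) := by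
  have h := Complex.integral_rpow_mul_exp_neg_mul_rpow (p := 2) (q := 2 * m) (b := b) (by norm_num)
    (by have : (0 : ℝ) ≤ m := m.cast_nonneg
        linarith) hb
  have e1 : ((2 : ℝ) * m + 2) / 2 = m + 1 := by ring
  rw [e1, Real.Gamma_nat_eq_factorial] at h
  have e2 : ∀ z : ℂ, ‖z‖ ^ (2 * (m : ℝ)) * Real.exp (-b * ‖z‖ ^ (2 : ℝ)) =
      ‖z‖ ^ (2 * m) * Real.exp (-b * ‖z‖ ^ 2) := fun z => by
    rw [← Real.rpow_natCast, ← Real.rpow_natCast]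
    push_cast
    rfl
  simp only [e2] at h
  rw [h]
  have e3 : b ^ (-(2 * (m : ℝ) + 2) / 2) = (b ^ (m + 1))⁻¹ := by
    rw [← Real.rpow_natCast, ← Real.rpow_neg hb.le]
    congr 1
    push_cast
    ring
  rw [e3]
  field_simp

/-- A non-integrable function has Bochner integral `0` by convention, whereas the value just
computed is positive. -/
theorem integrable_complex_pow_mul_exp (m : ℕ) (b : ℝ) (hb : 0 < b) :
    Integrable fun z : ℂ => ‖z‖ ^ (2 * m) * Real.exp (-b * ‖z‖ ^ 2) := by
  by_contra h
  have h1 := integral_complex_pow_mul_exp m b hb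
  rw [integral_undef h] at h1
  have : 0 < Real.pi * m.factorial / b ^ (m + 1) := by positivity
  linarith

theorem integral_complex_truncated (s : ℝ) (hs : 0 ≤ s) :
    ∫ z : ℂ, (if s ≤ ‖z‖ then Real.exp (-‖z‖ ^ 2) else 0) = Real.pi * Real.exp (-s ^ 2) := by
  rw [integral_complex_norm fun r => if s ≤ r then Real.exp (-r ^ 2) else 0]
  have : ∫ r in Set.Ioi (0 : ℝ), r * (if s ≤ r then Real.exp (-r ^ 2) else 0) =
      ∫ r in Set.Ioi s, r * Real.exp (-r ^ 2) := by
    rw [← integral_Ici_eq_integral_Ioi (x := s), ← integral_Ici_eq_integral_Ioi (x := (0 : ℝ)),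
      ← integral_indicator measurableSet_Ici, ← integral_indicator measurableSet_Ici]
    congr 1
    ext r
    simp only [Set.indicator, Set.mem_Ici, mul_ite, mul_zero]
    split_ifs <;> first | rfl | (exfalso; linarith)
  rw [this, integral_Ioi_mul_exp_neg_sq s hs]
  ring

/-! ### Gaussian integrals over `ℂ^d` -/

theorem gaussian_monomial (d : ℕ) (m : Fin d → ℕ) :
    ∫ x : Fin d → ℂ, (∏ i, ‖x i‖ ^ (2 * m i)) * ∏ i, Real.exp (-‖x i‖ ^ 2) =
      ∏ i, (Real.pi * (m i).factorial) := by
  simp only [← Finset.prod_mul_distrib]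
  rw [integral_fintype_prod_volume_eq_prod
    (fun i (z : ℂ) => ‖z‖ ^ (2 * m i) * Real.exp (-‖z‖ ^ 2))]
  refine Finset.prod_congr rfl fun i _ => ?_
  have := integral_complex_pow_mul_exp (m i) 1 one_pos
  simpa using this

/-- The Gaussian weight of the region where the coordinate `a` has minimal modulus. -/
theorem gaussian_argmin (n : ℕ) (a : Fin (n + 1)) (m : ℕ) :
    ∫ x : Fin (n + 1) → ℂ, (if ∀ k, ‖x a‖ ≤ ‖x k‖ then ‖x a‖ ^ (2 * m) else 0) *
        ∏ i, Real.exp (-‖x i‖ ^ 2) =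
      Real.pi ^ (n + 1) * m.factorial / (n + 1 : ℝ) ^ (m + 1) := by
  -- Splitting off the coordinate `a` makes the minimality condition a product of one condition for
  -- each remaining coordinate.
  rw [← (volume_preserving_piFinSuccAbove (fun _ : Fin (n + 1) => ℂ) a).symm.integral_comp']
  have key : ∀ y : ℂ × (Fin n → ℂ),
      (if ∀ k, ‖((MeasurableEquiv.piFinSuccAbove (fun _ : Fin (n + 1) => ℂ) a).symm y) a‖ ≤
          ‖((MeasurableEquiv.piFinSuccAbove (fun _ : Fin (n + 1) => ℂ) a).symm y) k‖ then
        ‖((MeasurableEquiv.piFinSuccAbove (fun _ : Fin (n + 1) => ℂ) a).symm y) a‖ ^ (2 * m)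
        else 0) *
        ∏ i, Real.exp (-‖((MeasurableEquiv.piFinSuccAbove (fun _ : Fin (n + 1) => ℂ) a).symm y) i‖
          ^ 2) =
      (‖y.1‖ ^ (2 * m) * Real.exp (-‖y.1‖ ^ 2)) *
        ∏ j, (if ‖y.1‖ ≤ ‖y.2 j‖ then Real.exp (-‖y.2 j‖ ^ 2) else 0) := by
    rintro ⟨z, w⟩
    simp only [MeasurableEquiv.piFinSuccAbove_symm_apply, Fin.insertNthEquiv_apply,
      Fin.insertNth_apply_same, Fin.prod_univ_succAbove _ a, Fin.insertNth_apply_succAbove,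
      Fin.forall_iff_succAbove a, le_refl, true_and]
    by_cases h : ∀ j, ‖z‖ ≤ ‖w j‖
    · simp [h, mul_assoc]
    · rw [if_neg h]
      push Not at h
      obtain ⟨j, hj⟩ := h
      have h0 : ∏ j, (if ‖z‖ ≤ ‖w j‖ then Real.exp (-‖w j‖ ^ 2) else 0) = 0 :=
        Finset.prod_eq_zero (Finset.mem_univ j) (if_neg (not_le.2 hj))
      rw [h0, zero_mul, mul_zero]
  simp only [key]
  have hint : Integrable (fun y : ℂ × (Fin n → ℂ) => (‖y.1‖ ^ (2 * m) * Real.exp (-‖y.1‖ ^ 2)) *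
        ∏ j, (if ‖y.1‖ ≤ ‖y.2 j‖ then Real.exp (-‖y.2 j‖ ^ 2) else 0))
      ((volume : Measure ℂ).prod (volume : Measure (Fin n → ℂ))) := by
    have h1 : Integrable fun z : ℂ => ‖z‖ ^ (2 * m) * Real.exp (-‖z‖ ^ 2) := by
      simpa using integrable_complex_pow_mul_exp m 1 one_pos
    have h2 : Integrable fun w : Fin n → ℂ => ∏ j, Real.exp (-‖w j‖ ^ 2) := by
      refine Integrable.fintype_prod (f := fun _ (z : ℂ) => Real.exp (-‖z‖ ^ 2)) fun _ => ?_
      simpa using integrable_complex_pow_mul_exp 0 1 one_pos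
    refine (h1.mul_prod h2).mono' ?_ (Filter.Eventually.of_forall fun y => ?_)
    · refine Measurable.aestronglyMeasurable ?_
      refine Measurable.mul (by fun_prop) (Finset.measurable_prod _ fun j _ => ?_)
      exact Measurable.ite (measurableSet_le (by fun_prop) (by fun_prop)) (by fun_prop)
        measurable_const
    · have h3 : 0 ≤ ∏ j, (if ‖y.1‖ ≤ ‖y.2 j‖ then Real.exp (-‖y.2 j‖ ^ 2) else 0) :=
        Finset.prod_nonneg fun j _ => by positivity
      rw [Real.norm_of_nonneg (by positivity)]
      refine mul_le_mul_of_nonneg_left (Finset.prod_le_prod (fun j _ => by positivity)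
        fun j _ => ?_) (by positivity)
      split_ifs
      · exact le_rfl
      · positivity
  rw [Measure.volume_eq_prod, integral_prod _ hint]
  -- Each of the `n` other coordinates integrates to `π exp(-‖z‖²)`. Together with the weight of `z`
  -- itself this gives the exponent `-(n+1)‖z‖²`, the source of the powers of `1/d`.
  have inner : ∀ z : ℂ, ∫ w : Fin n → ℂ, (‖z‖ ^ (2 * m) * Real.exp (-‖z‖ ^ 2)) *
        ∏ j, (if ‖z‖ ≤ ‖w j‖ then Real.exp (-‖w j‖ ^ 2) else 0) =
      Real.pi ^ n * (‖z‖ ^ (2 * m) * Real.exp (-(n + 1 : ℝ) * ‖z‖ ^ 2)) := fun z => by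
    rw [integral_const_mul, integral_fintype_prod_volume_eq_prod
      (fun _ (w : ℂ) => if ‖z‖ ≤ ‖w‖ then Real.exp (-‖w‖ ^ 2) else 0)]
    simp only [integral_complex_truncated _ (norm_nonneg z), Finset.prod_const, Finset.card_univ,
      Fintype.card_fin]
    rw [mul_pow, ← Real.exp_nat_mul]
    have : Real.exp (-(n + 1 : ℝ) * ‖z‖ ^ 2) =
        Real.exp (-‖z‖ ^ 2) * Real.exp (n * -‖z‖ ^ 2) := by
      rw [← Real.exp_add]
      congr 1
      ring
    rw [this]
    ring
  simp only [inner]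
  rw [integral_const_mul, integral_complex_pow_mul_exp m _ (by positivity)]
  ring

/-! ### Unitary invariance -/

/-- A linear equivalence scales an additive Haar measure by a constant; the unit ball is preserved
and has finite positive measure, so the constant is `1`. -/
theorem lebesgue_image_isometry {d : ℕ} [NeZero d]
    (φ : EuclideanSpace ℂ (Fin d) ≃ₗᵢ[ℂ] EuclideanSpace ℂ (Fin d))
    (s : Set (EuclideanSpace ℂ (Fin d))) :
    lebesgue d (φ '' s) = lebesgue d s := by
  have h := fun s => Measure.addHaar_image_continuousLinearEquiv (lebesgue d)
    (φ.toContinuousLinearEquiv.restrictScalars ℝ) s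
  have hb := h (Metric.ball 0 1)
  have hb' : (φ.toContinuousLinearEquiv.restrictScalars ℝ) '' (Metric.ball 0 1) =
      Metric.ball (0 : EuclideanSpace ℂ (Fin d)) 1 := by
    have := φ.image_ball 0 1
    rwa [map_zero] at this
  rw [hb'] at hb
  have h1 : lebesgue d (Metric.ball 0 1) ≠ 0 := (Metric.measure_ball_pos _ _ one_pos).ne'
  have h2 : lebesgue d (Metric.ball 0 1) ≠ ⊤ := measure_ball_lt_top.ne
  have hs := h s
  have hc := (ENNReal.mul_eq_right h1 h2).1 hb.symm
  rw [hc, one_mul] at hs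
  exact hs

/-- The action of an isometry on the unit sphere. -/
noncomputable def sphereEquiv {d : ℕ} (φ : EuclideanSpace ℂ (Fin d) ≃ₗᵢ[ℂ] EuclideanSpace ℂ (Fin d)) :
    PureState d ≃ₜ PureState d where
  toFun ψ := ⟨φ ψ.1, by simp⟩
  invFun ψ := ⟨φ.symm ψ.1, by simp⟩
  left_inv ψ := by simp
  right_inv ψ := by simp
  continuous_toFun := by fun_prop
  continuous_invFun := by fun_prop

/-- Surface measure of a set is, up to the dimension, the Lebesgue measure of the cone over it, and
linear isometries carry cones to cones. -/
theorem measurePreserving_sphereEquiv {d : ℕ} [NeZero d]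
    (φ : EuclideanSpace ℂ (Fin d) ≃ₗᵢ[ℂ] EuclideanSpace ℂ (Fin d)) :
    MeasurePreserving (sphereEquiv φ) (haarPure d) (haarPure d) := by
  have h : MeasurePreserving (sphereEquiv φ) (lebesgue d).toSphere (lebesgue d).toSphere := by
    refine ⟨(sphereEquiv φ).measurable, ?_⟩
    ext s hs
    rw [Measure.map_apply (sphereEquiv φ).measurable hs, Measure.toSphere_apply' _ hs,
      Measure.toSphere_apply' _ ((sphereEquiv φ).measurable hs), ← lebesgue_image_isometry φ]
    congr 2
    ext z
    simp only [Set.mem_image, Set.mem_smul]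
    constructor
    · rintro ⟨w, ⟨r, hr, v, ⟨ψ, hψ, rfl⟩, rfl⟩, rfl⟩
      refine ⟨r, hr, _, ⟨sphereEquiv φ ψ, hψ, rfl⟩, ?_⟩
      exact (LinearMap.map_smul_of_tower φ.toLinearEquiv.toLinearMap r ψ.1).symm
    · rintro ⟨r, hr, v, ⟨ψ, hψ, rfl⟩, rfl⟩
      refine ⟨r • φ.symm ψ.1, ⟨r, hr, _, ⟨(sphereEquiv φ).symm ψ, ?_, rfl⟩, rfl⟩, ?_⟩
      · rwa [Set.mem_preimage, Homeomorph.apply_symm_apply]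
      · refine (LinearMap.map_smul_of_tower φ.toLinearEquiv.toLinearMap r (φ.symm ψ.1)).trans ?_
        exact congrArg (r • ·) (φ.apply_symm_apply ψ.1)
  exact ⟨h.measurable, by rw [haarPure, Measure.map_smul, h.map_eq]⟩

theorem integral_sphereEquiv {d : ℕ} [NeZero d] {F : Type*} [NormedAddCommGroup F]
    [NormedSpace ℝ F] (φ : EuclideanSpace ℂ (Fin d) ≃ₗᵢ[ℂ] EuclideanSpace ℂ (Fin d))
    (f : PureState d → F) :
    ∫ ψ, f (sphereEquiv φ ψ) ∂(haarPure d) = ∫ ψ, f ψ ∂(haarPure d) :=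
  (measurePreserving_sphereEquiv φ).integral_comp (sphereEquiv φ).measurableEmbedding f

/-! ### Moments of Haar-random pure states -/

theorem sum_norm_sq_pureState {d : ℕ} (ψ : PureState d) : ∑ i, ‖ψ.1 i‖ ^ 2 = 1 := by
  rw [← EuclideanSpace.norm_sq_eq, norm_eq_of_mem_sphere, one_pow]

theorem norm_coord_sq_le_one {d : ℕ} (ψ : PureState d) (i : Fin d) : ‖ψ.1 i‖ ^ 2 ≤ 1 := by
  have h := Finset.single_le_sum (f := fun i => ‖ψ.1 i‖ ^ 2) (fun _ _ => by positivity)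
    (Finset.mem_univ i)
  rwa [sum_norm_sq_pureState ψ] at h

theorem integrable_continuous_haarPure {d : ℕ} [NeZero d] {f : PureState d → ℝ}
    (hf : Continuous f) : Integrable f (haarPure d) := by
  have : CompactSpace (PureState d) := isCompact_iff_compactSpace.1 (isCompact_sphere _ _)
  exact hf.integrable_of_hasCompactSupport (HasCompactSupport.of_compactSpace f)

theorem gaussian_eq_haarPure_zero (d : ℕ) [NeZero d] (f : EuclideanSpace ℂ (Fin d) → ℝ)
    (hf : ∀ r : ℝ, 0 < r → ∀ z, f (r • z) = f z) :
    ∫ x : Fin d → ℂ, f (WithLp.toLp 2 x) * ∏ i, Real.exp (-‖x i‖ ^ 2) =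
      Real.pi ^ d * ∫ ψ, f ψ.1 ∂(haarPure d) := by
  obtain ⟨C, hC⟩ := exists_gaussian_eq_haarPure d 0
  have h1 := hC (fun _ => 1) (by simp)
  have h2 := gaussian_monomial d (fun _ => 0)
  simp at h1 h2
  rw [hC f (by simpa using hf), ← h1, h2]

/-- The constant is found by summing the monomials `‖z a‖²`, each of Gaussian integral `π^d`, whose
sum is `1` on the sphere. In degree zero the test function is `1`. -/
theorem gaussian_eq_haarPure_two (d : ℕ) [NeZero d] (f : EuclideanSpace ℂ (Fin d) → ℝ)
    (hf : ∀ r : ℝ, 0 < r → ∀ z, f (r • z) = r ^ 2 * f z) :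
    ∫ x : Fin d → ℂ, f (WithLp.toLp 2 x) * ∏ i, Real.exp (-‖x i‖ ^ 2) =
      d * Real.pi ^ d * ∫ ψ, f ψ.1 ∂(haarPure d) := by
  obtain ⟨C, hC⟩ := exists_gaussian_eq_haarPure d 2
  have h1 : ∀ a : Fin d, Real.pi ^ d = C * ∫ ψ : PureState d, ‖ψ.1 a‖ ^ 2 ∂(haarPure d) := by
    intro a
    rw [← hC (fun z => ‖z a‖ ^ 2)
      (fun r hr z => by simp [mul_pow])]
    have h2 := gaussian_monomial d (fun i => if i = a then 1 else 0)
    have e1 : ∀ x : Fin d → ℂ, ∏ i, ‖x i‖ ^ (2 * if i = a then 1 else 0) = ‖x a‖ ^ 2 := fun x => by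
      simp [mul_ite, pow_ite]
    have e2 : ∏ i : Fin d, (Real.pi * ((if i = a then 1 else 0 : ℕ).factorial : ℝ)) =
        Real.pi ^ d := by
      rw [Finset.prod_congr rfl (g := fun _ => Real.pi) fun i _ => by split_ifs <;> simp]
      simp
    simp only [e1, e2] at h2
    exact h2.symm
  have h3 : d * Real.pi ^ d = C := by
    calc d * Real.pi ^ d = ∑ a : Fin d, C * ∫ ψ : PureState d, ‖ψ.1 a‖ ^ 2 ∂(haarPure d) := by
          rw [← Finset.sum_congr rfl fun a _ => h1 a]
          simp
      _ = C * ∫ ψ : PureState d, ∑ a, ‖ψ.1 a‖ ^ 2 ∂(haarPure d) := by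
          rw [← Finset.mul_sum, integral_finsetSum]
          intro a _
          exact integrable_continuous_haarPure (by fun_prop)
      _ = C := by simp [sum_norm_sq_pureState]
  rw [hC f hf, h3]

/-- The monomials `‖z a‖² ‖z b‖²` also sum to `1` on the sphere. Their Gaussian integrals are `π^d`,
doubled on the diagonal, hence the total `(d² + d) π^d`. -/
theorem gaussian_eq_haarPure_four (d : ℕ) [NeZero d] (f : EuclideanSpace ℂ (Fin d) → ℝ)
    (hf : ∀ r : ℝ, 0 < r → ∀ z, f (r • z) = r ^ 4 * f z) :
    ∫ x : Fin d → ℂ, f (WithLp.toLp 2 x) * ∏ i, Real.exp (-‖x i‖ ^ 2) =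
      d * (d + 1) * Real.pi ^ d * ∫ ψ, f ψ.1 ∂(haarPure d) := by
  obtain ⟨C, hC⟩ := exists_gaussian_eq_haarPure d 4
  have h1 : ∀ a b : Fin d, (if a = b then 2 else 1) * Real.pi ^ d =
      C * ∫ ψ : PureState d, ‖ψ.1 a‖ ^ 2 * ‖ψ.1 b‖ ^ 2 ∂(haarPure d) := by
    intro a b
    rw [← hC (fun z => ‖z a‖ ^ 2 * ‖z b‖ ^ 2)
      (fun r hr z => by simp [mul_pow]; ring)]
    have h2 := gaussian_monomial d (fun i => (if i = a then 1 else 0) + if i = b then 1 else 0)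
    have e1 : ∀ x : Fin d → ℂ,
        ∏ i, ‖x i‖ ^ (2 * ((if i = a then 1 else 0) + if i = b then 1 else 0)) =
          ‖x a‖ ^ 2 * ‖x b‖ ^ 2 := fun x => by
      simp only [mul_add, pow_add, Finset.prod_mul_distrib]
      simp [mul_ite, pow_ite]
    have e2 : ∏ i : Fin d,
        (Real.pi * (((if i = a then 1 else 0) + if i = b then 1 else 0 : ℕ).factorial : ℝ)) =
        (if a = b then 2 else 1) * Real.pi ^ d := by
      rw [Finset.prod_mul_distrib, mul_comm]
      simp only [Finset.prod_const, Finset.card_univ, Fintype.card_fin]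
      congr 1
      by_cases hab : a = b
      · subst hab
        rw [Finset.prod_eq_single a (fun i _ hi => by simp [hi]) (by simp)]
        simp
      · rw [if_neg hab]
        refine Finset.prod_eq_one fun i _ => ?_
        by_cases hi : i = a
        · subst hi; simp [hab]
        · by_cases hi' : i = b
          · subst hi'; simp [hi]
          · simp [hi, hi']
    simp only [e1, e2] at h2
    exact h2.symm
  have h3 : d * (d + 1) * Real.pi ^ d = C := by
    calc d * (d + 1) * Real.pi ^ d = ∑ a : Fin d, ∑ b : Fin d,
          C * ∫ ψ : PureState d, ‖ψ.1 a‖ ^ 2 * ‖ψ.1 b‖ ^ 2 ∂(haarPure d) := by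
          rw [← Finset.sum_congr rfl fun a _ => Finset.sum_congr rfl fun b _ => h1 a b]
          have : ∀ a b : Fin d, ((if a = b then 2 else 1 : ℝ)) = (if a = b then 1 else 0) + 1 :=
            fun a b => by split_ifs <;> norm_num
          simp only [this, ← Finset.sum_mul, Finset.sum_add_distrib]
          simp
          ring
      _ = C * ∫ ψ : PureState d, ∑ a, ∑ b, ‖ψ.1 a‖ ^ 2 * ‖ψ.1 b‖ ^ 2 ∂(haarPure d) := by
          simp only [← Finset.mul_sum]
          rw [integral_finsetSum]
          · congr 1
            refine Finset.sum_congr rfl fun a _ => ?_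
            simp only [Finset.mul_sum]
            rw [integral_finsetSum]
            intro b _
            exact integrable_continuous_haarPure (by fun_prop)
          · intro a _
            exact integrable_continuous_haarPure (by fun_prop)
      _ = C := by
          simp only [← Finset.mul_sum, ← Finset.sum_mul, sum_norm_sq_pureState]
          simp
  rw [hC f hf, h3]

/-! ### Werner's response and its moments -/

/-- Werner's response as a function of the moduli of the amplitudes. -/
noncomputable def wernerProfile {d : ℕ} (a : Fin d) (u : Fin d → ℝ) : ℝ :=
  open Classical in if ∀ k, u a ≤ u k then 1 else 0

theorem measurable_wernerProfile {d : ℕ} (a : Fin d) : Measurable (wernerProfile a) := by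
  classical
  unfold wernerProfile
  refine Measurable.ite ?_ measurable_const measurable_const
  have : {u : Fin d → ℝ | ∀ k, u a ≤ u k} = ⋂ k, {u | u a ≤ u k} := by ext; simp
  rw [this]
  exact MeasurableSet.iInter fun k => measurableSet_le (by fun_prop) (by fun_prop)

theorem wernerProfile_nonneg {d : ℕ} (a : Fin d) (u : Fin d → ℝ) : 0 ≤ wernerProfile a u := by
  unfold wernerProfile; positivity

theorem wernerProfile_le_one {d : ℕ} (a : Fin d) (u : Fin d → ℝ) : wernerProfile a u ≤ 1 := by
  unfold wernerProfile; split_ifs <;> norm_num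

theorem wernerProfile_comp_perm {d : ℕ} (a : Fin d) (u : Fin d → ℝ) (σ : Equiv.Perm (Fin d)) :
    wernerProfile a (fun k => u (σ k)) = wernerProfile (σ a) u := by
  have : (∀ k, u (σ a) ≤ u (σ k)) ↔ ∀ k, u (σ a) ≤ u k :=
    ⟨fun h k => by simpa using h (σ.symm k), fun h k => h _⟩
  simp only [wernerProfile, this]

/-- The moduli of the amplitudes. -/
noncomputable def moduli {d : ℕ} (ψ : PureState d) : Fin d → ℝ := fun k => ‖ψ.1 k‖

theorem continuous_moduli {d : ℕ} : Continuous (moduli (d := d)) := by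
  unfold moduli; fun_prop

theorem gaussian_wernerProfile (d : ℕ) [NeZero d] (a : Fin d) (m : ℕ) :
    ∫ x : Fin d → ℂ, (‖x a‖ ^ (2 * m) * wernerProfile a fun k => ‖x k‖) *
      ∏ i, Real.exp (-‖x i‖ ^ 2) = Real.pi ^ d * m.factorial / (d : ℝ) ^ (m + 1) := by
  obtain ⟨n, rfl⟩ := Nat.exists_eq_succ_of_ne_zero (NeZero.ne d)
  have := gaussian_argmin n a m
  push_cast
  rw [← this]
  refine integral_congr_ae (Filter.Eventually.of_forall fun x => ?_)
  simp [wernerProfile]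

theorem wernerProfile_smul {d : ℕ} (a : Fin d) (r : ℝ) (hr : 0 < r)
    (z : EuclideanSpace ℂ (Fin d)) :
    wernerProfile a (fun k => ‖(r • z) k‖) = wernerProfile a fun k => ‖z k‖ := by
  simp only [wernerProfile, PiLp.smul_apply, norm_smul, Real.norm_of_nonneg hr.le,
    mul_le_mul_iff_right₀ hr]

theorem integral_wernerProfile (d : ℕ) [NeZero d] (a : Fin d) :
    ∫ ψ, wernerProfile a (moduli ψ) ∂(haarPure d) = 1 / d := by
  have h := gaussian_eq_haarPure_zero d (fun z => wernerProfile a fun k => ‖z k‖)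
    (fun r hr z => wernerProfile_smul a r hr z)
  have h2 := gaussian_wernerProfile d a 0
  simp at h2
  rw [h2] at h
  have hp : Real.pi ^ d ≠ 0 := by positivity
  have : (Real.pi ^ d) * (∫ ψ, wernerProfile a (moduli ψ) ∂(haarPure d)) =
    Real.pi ^ d * (1 / d) := by
    rw [mul_one_div]; exact h.symm
  exact mul_left_cancel₀ hp this

/-- The Gaussian integral is `π^d / d²`, and the normalization `d π^d` in degree two leaves `1/d³`.
-/
theorem integral_sq_mul_wernerProfile (d : ℕ) [NeZero d] (a : Fin d) :
    ∫ ψ : PureState d, ‖ψ.1 a‖ ^ 2 * wernerProfile a (moduli ψ) ∂(haarPure d) =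
      1 / (d : ℝ) ^ 3 := by
  have h := gaussian_eq_haarPure_two d (fun z => ‖z a‖ ^ 2 * wernerProfile a fun k => ‖z k‖)
    (fun r hr z => by
      simp only [wernerProfile_smul a r hr z]
      simp [mul_pow, mul_assoc])
  have h2 := gaussian_wernerProfile d a 1
  simp at h2
  rw [h2] at h
  have hd : (d : ℝ) ≠ 0 := NeZero.ne _
  have hp : (d : ℝ) * Real.pi ^ d ≠ 0 := by positivity
  refine mul_left_cancel₀ hp (h.symm.trans ?_)
  field_simp

theorem integral_pow_four (d : ℕ) [NeZero d] (a : Fin d) :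
    ∫ ψ : PureState d, ‖ψ.1 a‖ ^ 2 * ‖ψ.1 a‖ ^ 2 ∂(haarPure d) = 2 / ((d : ℝ) * (d + 1)) := by
  have h := gaussian_eq_haarPure_four d (fun z => ‖z a‖ ^ 2 * ‖z a‖ ^ 2)
    (fun r hr z => by simp [mul_pow]; ring)
  have h2 := gaussian_monomial d (fun i => if i = a then 2 else 0)
  have e1 : ∀ x : Fin d → ℂ, ∏ i, ‖x i‖ ^ (2 * if i = a then 2 else 0) =
      ‖x a‖ ^ 2 * ‖x a‖ ^ 2 := fun x => by
    simp [mul_ite, pow_ite, ← pow_add]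
  have e2 : ∏ i : Fin d, (Real.pi * ((if i = a then 2 else 0 : ℕ).factorial : ℝ)) =
      2 * Real.pi ^ d := by
    rw [Finset.prod_mul_distrib, mul_comm, Finset.prod_eq_single a (fun i _ hi => by simp [hi])
      (by simp)]
    simp
  simp only [e1, e2] at h2
  rw [h2] at h
  have hd : (d : ℝ) ≠ 0 := NeZero.ne _
  have hp : (d : ℝ) * (d + 1) * Real.pi ^ d ≠ 0 := by positivity
  refine mul_left_cancel₀ hp (h.symm.trans ?_)
  field_simp

theorem integrable_profile {d : ℕ} [NeZero d] {R : (Fin d → ℝ) → ℝ} (hm : Measurable R)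
    (h0 : ∀ ψ : PureState d, 0 ≤ R (moduli ψ)) (h1 : ∀ ψ : PureState d, R (moduli ψ) ≤ 1) :
    Integrable (fun ψ : PureState d => R (moduli ψ)) (haarPure d) :=
  Integrable.of_bound (hm.comp continuous_moduli.measurable).aestronglyMeasurable 1
    (Filter.Eventually.of_forall fun ψ => by rw [Real.norm_of_nonneg (h0 ψ)]; exact h1 ψ)

/-- Ties are negligible, with no study of the tie set: some coordinate is always minimal, so the sum
is at least `1`, while its mean is `d · (1/d) = 1`. -/
theorem ae_sum_wernerProfile (d : ℕ) [NeZero d] :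
    ∀ᵐ ψ ∂(haarPure d), ∑ a, wernerProfile a (moduli ψ) = 1 := by
  have hint : ∀ a : Fin d, Integrable (fun ψ : PureState d => wernerProfile a (moduli ψ))
      (haarPure d) := fun a => integrable_profile (measurable_wernerProfile a)
        (fun _ => wernerProfile_nonneg _ _) (fun _ => wernerProfile_le_one _ _)
  have hge : ∀ ψ : PureState d, 1 ≤ ∑ a, wernerProfile a (moduli ψ) := by
    intro ψ
    obtain ⟨a, ha⟩ := Finite.exists_min (moduli ψ)
    have h1 : wernerProfile a (moduli ψ) = 1 := if_pos ha
    rw [← h1]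
    exact Finset.single_le_sum (f := fun a => wernerProfile a (moduli ψ))
      (fun _ _ => wernerProfile_nonneg _ _) (Finset.mem_univ a)
  have hint' : Integrable (fun ψ : PureState d => ∑ a, wernerProfile a (moduli ψ) - 1)
      (haarPure d) := (integrable_finsetSum _ fun a _ => hint a).sub (integrable_const 1)
  have hd : (d : ℝ) ≠ 0 := NeZero.ne _
  have hz : ∫ ψ, (∑ a, wernerProfile a (moduli ψ) - 1) ∂(haarPure d) = 0 := by
    rw [integral_sub (integrable_finsetSum _ fun a _ => hint a) (integrable_const 1),
      integral_finsetSum _ fun a _ => hint a]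
    simp [integral_wernerProfile, hd]
  rw [integral_eq_zero_iff_of_nonneg (fun ψ => sub_nonneg.2 (hge ψ)) hint'] at hz
  filter_upwards [hz] with ψ h
  exact sub_eq_zero.1 h

/-! ### Ensembles -/

theorem isDensityMatrix_ketBra {d : ℕ} {v : EuclideanSpace ℂ (Fin d)} (hv : ‖v‖ = 1) :
    IsDensityMatrix (ketBra v) := by
  refine ⟨Matrix.posSemidef_vecMulVec_self_star v.ofLp, ?_⟩
  rw [trace_ketBra, hv]
  simp

/-- The spectral decomposition of a density matrix. -/
theorem IsDensityMatrix.exists_spectral {d : ℕ} {ρ : Matrix (Fin d) (Fin d) ℂ}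
    (hρ : IsDensityMatrix ρ) :
    ∃ (b : OrthonormalBasis (Fin d) ℂ (EuclideanSpace ℂ (Fin d))) (c : Fin d → ℝ),
      (∀ k, 0 ≤ c k) ∧ ∑ k, c k = 1 ∧ ρ = ∑ k, (c k : ℂ) • ketBra (b k) := by
  let A : Observable (Fin d) := ⟨ρ, hρ.1.isHermitian⟩
  have h : ρ = ∑ k, (A.2.eigenvalues k : ℂ) • ketBra (A.2.eigenvectorBasis k) := by
    apply Matrix.toEuclideanLin.injective
    refine A.2.eigenvectorBasis.toBasis.ext fun j => ?_
    rw [OrthonormalBasis.coe_toBasis]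
    exact (toEuclideanLin_eigenvectorBasis A j).trans
      (toEuclideanLin_basisObservable A.2.eigenvectorBasis A.2.eigenvalues j).symm
  refine ⟨A.2.eigenvectorBasis, A.2.eigenvalues, fun k => hρ.1.eigenvalues_nonneg k, ?_, h⟩
  have ht := hρ.2
  rw [h, Matrix.trace_sum] at ht
  simp only [Matrix.trace_smul, trace_ketBra, OrthonormalBasis.norm_eq_one] at ht
  have : ((∑ k, A.2.eigenvalues k : ℝ) : ℂ) = 1 := by
    push_cast
    simpa using ht
  exact_mod_cast this

theorem inner_spectral {d : ℕ} {b : OrthonormalBasis (Fin d) ℂ (EuclideanSpace ℂ (Fin d))}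
    {c : Fin d → ℝ} (v w : EuclideanSpace ℂ (Fin d)) :
    inner ℂ v (Matrix.toEuclideanLin (∑ k, (c k : ℂ) • ketBra (b k)) w) =
      ∑ k, (c k : ℂ) * (inner ℂ (b k) w * inner ℂ v (b k)) := by
  simp only [map_sum, map_smul, LinearMap.sum_apply, LinearMap.smul_apply, toEuclideanLin_ketBra,
    inner_sum, inner_smul_right]

/-- The Cauchy-Schwarz bound for each eigenprojection survives convex combination. Being uniform in
the state, it makes integrands over an ensemble integrable. -/
theorem IsDensityMatrix.norm_inner_le {d : ℕ} {ρ : Matrix (Fin d) (Fin d) ℂ}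
    (hρ : IsDensityMatrix ρ) (v w : EuclideanSpace ℂ (Fin d)) :
    ‖inner ℂ v (Matrix.toEuclideanLin ρ w)‖ ≤ ‖v‖ * ‖w‖ := by
  obtain ⟨b, c, hc, hs, rfl⟩ := hρ.exists_spectral
  rw [inner_spectral]
  refine (norm_sum_le _ _).trans ?_
  calc _ ≤ ∑ k, c k * (‖v‖ * ‖w‖) := by
        refine Finset.sum_le_sum fun k _ => ?_
        rw [norm_mul, norm_mul, Complex.norm_real, Real.norm_of_nonneg (hc k), mul_comm ‖v‖]
        refine mul_le_mul_of_nonneg_left (mul_le_mul ?_ ?_ (norm_nonneg _) (norm_nonneg _)) (hc k)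
        · simpa using norm_inner_le_norm (𝕜 := ℂ) (b k) w
        · simpa using norm_inner_le_norm (𝕜 := ℂ) v (b k)
    _ = ‖v‖ * ‖w‖ := by rw [← Finset.sum_mul, hs, one_mul]

theorem IsEnsemble.measurable_inner {Ξ : Type u} [MeasurableSpace Ξ] {d : ℕ} {μ : Measure Ξ}
    {ρ : Ξ → Matrix (Fin d) (Fin d) ℂ} (h : IsEnsemble μ ρ) (v w : EuclideanSpace ℂ (Fin d)) :
    Measurable fun ξ => inner ℂ v (Matrix.toEuclideanLin (ρ ξ) w) := by
  simp only [inner_toEuclideanLin_eq_sum]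
  exact Finset.measurable_sum _ fun i _ => Finset.measurable_sum _ fun j _ =>
    ((h.meas i j).const_mul _).mul_const _

theorem IsEnsemble.integrable_mul_inner {Ξ : Type u} [MeasurableSpace Ξ] {d : ℕ} {μ : Measure Ξ}
    {ρ : Ξ → Matrix (Fin d) (Fin d) ℂ} (h : IsEnsemble μ ρ) {p : Ξ → ℝ} (hp : Integrable p μ)
    (v w : EuclideanSpace ℂ (Fin d)) :
    Integrable (fun ξ => (p ξ : ℂ) * inner ℂ v (Matrix.toEuclideanLin (ρ ξ) w)) μ :=
  hp.ofReal.mul_bdd (c := ‖v‖ * ‖w‖) (h.measurable_inner v w).aestronglyMeasurable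
    (Filter.Eventually.of_forall fun ξ => (h.state ξ).norm_inner_le v w)

/-- Matrix elements of an ensemble average. -/
theorem IsEnsemble.inner_ensembleAverage {Ξ : Type u} [MeasurableSpace Ξ] {d : ℕ} {μ : Measure Ξ}
    {ρ : Ξ → Matrix (Fin d) (Fin d) ℂ} (h : IsEnsemble μ ρ) {p : Ξ → ℝ} (hp : Integrable p μ)
    (v w : EuclideanSpace ℂ (Fin d)) :
    inner ℂ v (Matrix.toEuclideanLin (ensembleAverage μ ρ p) w) =
      ∫ ξ, (p ξ : ℂ) * inner ℂ v (Matrix.toEuclideanLin (ρ ξ) w) ∂μ := by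
  have hij : ∀ i j, Integrable (fun ξ => (p ξ : ℂ) * ρ ξ i j) μ := fun i j => by
    have := h.integrable_mul_inner hp (EuclideanSpace.single i 1) (EuclideanSpace.single j 1)
    refine this.congr (Filter.Eventually.of_forall fun ξ => ?_)
    simp [Matrix.toLpLin_apply, EuclideanSpace.inner_single_left]
  have e : ∀ ξ, (p ξ : ℂ) * inner ℂ v (Matrix.toEuclideanLin (ρ ξ) w) =
      ∑ i, ∑ j, star (v i) * ((p ξ : ℂ) * ρ ξ i j) * w j := fun ξ => by
    rw [inner_toEuclideanLin_eq_sum, Finset.mul_sum]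
    refine Finset.sum_congr rfl fun i _ => ?_
    rw [Finset.mul_sum]
    refine Finset.sum_congr rfl fun j _ => by ring
  simp only [e]
  have hij' : ∀ i j, Integrable (fun ξ => star (v i) * ((p ξ : ℂ) * ρ ξ i j) * w j) μ :=
    fun i j => ((hij i j).const_mul _).mul_const _
  rw [inner_toEuclideanLin_eq_sum,
    integral_finsetSum _ fun i _ => integrable_finsetSum _ fun j _ => hij' i j]
  refine Finset.sum_congr rfl fun i _ => ?_
  rw [integral_finsetSum _ fun j _ => hij' i j]
  refine Finset.sum_congr rfl fun j _ => ?_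
  rw [integral_mul_const, integral_const_mul]
  rfl

theorem isEnsemble_haarPure (d : ℕ) [NeZero d] :
    IsEnsemble (haarPure d) (fun ψ : PureState d => ketBra ψ.1) where
  prob := inferInstance
  meas i j := by
    unfold ketBra
    refine Continuous.measurable ?_
    simp only [Matrix.of_apply]
    fun_prop
  state ψ := isDensityMatrix_ketBra (norm_eq_of_mem_sphere ψ)

theorem inner_ketBra {d : ℕ} (ψ v w : EuclideanSpace ℂ (Fin d)) :
    inner ℂ v (Matrix.toEuclideanLin (ketBra ψ) w) = inner ℂ v ψ * inner ℂ ψ w := by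
  rw [toEuclideanLin_ketBra, inner_smul_right, mul_comm]

theorem IsResponse.integrable {Ξ : Type u} [MeasurableSpace Ξ] {α : Type} {μ : Measure Ξ}
    [IsFiniteMeasure μ] {s : Finset α} {p : α → Ξ → ℝ} (h : IsResponse μ s p) {a : α}
    (ha : a ∈ s) : Integrable (p a) μ := by
  refine Integrable.of_bound (h.1 a ha).aestronglyMeasurable 1 ?_
  filter_upwards [h.2] with ξ hξ
  rw [Real.norm_of_nonneg (hξ.1 a ha), ← hξ.2]
  exact Finset.single_le_sum (fun b hb => hξ.1 b hb) ha

/-! ### Symmetric responses -/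

/-- Reversal of the sign of the coordinate `k`. -/
noncomputable def signFlip {d : ℕ} (k : Fin d) :
    EuclideanSpace ℂ (Fin d) ≃ₗᵢ[ℂ] EuclideanSpace ℂ (Fin d) :=
  LinearIsometryEquiv.piLpCongrRight 2 fun i =>
    if i = k then LinearIsometryEquiv.neg ℂ else LinearIsometryEquiv.refl ℂ ℂ

theorem signFlip_apply {d : ℕ} (k i : Fin d) (z : EuclideanSpace ℂ (Fin d)) :
    signFlip k z i = if i = k then -z i else z i := by
  simp only [signFlip, LinearIsometryEquiv.piLpCongrRight_apply]
  split_ifs <;> simp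

/-- Permutation of the coordinates. -/
noncomputable def permIso {d : ℕ} (σ : Equiv.Perm (Fin d)) :
    EuclideanSpace ℂ (Fin d) ≃ₗᵢ[ℂ] EuclideanSpace ℂ (Fin d) :=
  LinearIsometryEquiv.piLpCongrLeft 2 ℂ ℂ σ

theorem permIso_apply {d : ℕ} (σ : Equiv.Perm (Fin d)) (i : Fin d)
    (z : EuclideanSpace ℂ (Fin d)) : permIso σ z i = z (σ.symm i) := by
  simp [permIso, LinearIsometryEquiv.piLpCongrLeft_apply, Equiv.piCongrLeft'_apply]

theorem moduli_signFlip {d : ℕ} (k : Fin d) (ψ : PureState d) :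
    moduli (sphereEquiv (signFlip k) ψ) = moduli ψ := by
  ext i
  change ‖signFlip k ψ.1 i‖ = ‖ψ.1 i‖
  rw [signFlip_apply]
  split_ifs <;> simp

theorem moduli_permIso {d : ℕ} (σ : Equiv.Perm (Fin d)) (ψ : PureState d) :
    moduli (sphereEquiv (permIso σ) ψ) = fun k => moduli ψ (σ.symm k) := by
  ext i
  change ‖permIso σ ψ.1 i‖ = _
  rw [permIso_apply]
  rfl

/-- A response function, expressed by the moduli of the amplitudes, that treats all results
alike. -/
structure IsSymmetricResponse {d : ℕ} (R : Fin d → (Fin d → ℝ) → ℝ) : Prop where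
  meas : ∀ a, Measurable (R a)
  nonneg : ∀ a (ψ : PureState d), 0 ≤ R a (moduli ψ)
  le_one : ∀ a (ψ : PureState d), R a (moduli ψ) ≤ 1
  perm : ∀ a u (σ : Equiv.Perm (Fin d)), R a (fun k => u (σ k)) = R (σ a) u
  sum_eq_one : ∀ᵐ ψ ∂(haarPure d), ∑ a, R a (moduli ψ) = 1

namespace IsSymmetricResponse

variable {d : ℕ} [NeZero d] {R : Fin d → (Fin d → ℝ) → ℝ}

theorem integrable (h : IsSymmetricResponse R) (a : Fin d) :
    Integrable (fun ψ : PureState d => R a (moduli ψ)) (haarPure d) :=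
  integrable_profile (h.meas a) (h.nonneg a) (h.le_one a)

/-- Swapping coordinates makes the integrals for all outcomes equal, and they add up to `1`. -/
theorem integral_eq (h : IsSymmetricResponse R) (a : Fin d) :
    ∫ ψ, R a (moduli ψ) ∂(haarPure d) = 1 / d := by
  have h1 : ∀ b, ∫ ψ, R b (moduli ψ) ∂(haarPure d) = ∫ ψ, R a (moduli ψ) ∂(haarPure d) := by
    intro b
    rw [← integral_sphereEquiv (permIso (Equiv.swap a b)) fun ψ => R a (moduli ψ)]
    refine integral_congr_ae (Filter.Eventually.of_forall fun ψ => ?_)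
    simp only [moduli_permIso]
    rw [h.perm a (moduli ψ) (Equiv.swap a b).symm]
    simp
  have h2 : ∫ ψ, ∑ b, R b (moduli ψ) ∂(haarPure d) = 1 := by
    rw [integral_congr_ae h.sum_eq_one]
    simp
  rw [integral_finsetSum _ fun b _ => h.integrable b, Finset.sum_congr rfl fun b _ => h1 b] at h2
  have hd : (d : ℝ) ≠ 0 := NeZero.ne _
  simp at h2
  field_simp
  linarith

/-- Reversing the sign of coordinate `i` preserves the measure and all moduli but negates the
integrand. -/
theorem integral_offDiag (a : Fin d) {i j : Fin d} (hij : i ≠ j) :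
    ∫ ψ : PureState d, (R a (moduli ψ) : ℂ) * (ψ.1 i * star (ψ.1 j)) ∂(haarPure d) = 0 := by
  have h1 := integral_sphereEquiv (signFlip i)
    fun ψ : PureState d => (R a (moduli ψ) : ℂ) * (ψ.1 i * star (ψ.1 j))
  have h2 : ∀ ψ : PureState d, (R a (moduli (sphereEquiv (signFlip i) ψ)) : ℂ) *
      ((sphereEquiv (signFlip i) ψ).1 i * star ((sphereEquiv (signFlip i) ψ).1 j)) =
      -((R a (moduli ψ) : ℂ) * (ψ.1 i * star (ψ.1 j))) := fun ψ => by
    rw [moduli_signFlip]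
    change _ * (signFlip i ψ.1 i * star (signFlip i ψ.1 j)) = _
    rw [signFlip_apply, signFlip_apply, if_pos rfl, if_neg hij.symm]
    ring
  simp only [h2] at h1
  rw [integral_neg] at h1
  exact self_eq_neg.1 h1.symm

theorem integrable_sq_mul (h : IsSymmetricResponse R) (a i : Fin d) :
    Integrable (fun ψ : PureState d => ‖ψ.1 i‖ ^ 2 * R a (moduli ψ)) (haarPure d) := by
  refine (h.integrable a).bdd_mul (c := 1) (Continuous.aestronglyMeasurable (by fun_prop))
    (Filter.Eventually.of_forall fun ψ => ?_)
  rw [Real.norm_of_nonneg (by positivity)]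
  exact norm_coord_sq_le_one ψ i

/-- Swaps that fix `a` equate the `d - 1` other diagonal entries, which share what the `a`-th entry
leaves of the trace `1/d`. -/
theorem integral_diag (h : IsSymmetricResponse R) (hd : 2 ≤ d) {a i : Fin d} (hi : i ≠ a) :
    ∫ ψ : PureState d, ‖ψ.1 i‖ ^ 2 * R a (moduli ψ) ∂(haarPure d) =
      (1 / d - ∫ ψ : PureState d, ‖ψ.1 a‖ ^ 2 * R a (moduli ψ) ∂(haarPure d)) / (d - 1) := by
  have h1 : ∀ j ∈ Finset.univ.erase a,
      ∫ ψ : PureState d, ‖ψ.1 j‖ ^ 2 * R a (moduli ψ) ∂(haarPure d) =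
      ∫ ψ : PureState d, ‖ψ.1 i‖ ^ 2 * R a (moduli ψ) ∂(haarPure d) := by
    intro j hj
    have hj' := Finset.ne_of_mem_erase hj
    rw [← integral_sphereEquiv (permIso (Equiv.swap i j))
      fun ψ : PureState d => ‖ψ.1 i‖ ^ 2 * R a (moduli ψ)]
    refine integral_congr_ae (Filter.Eventually.of_forall fun ψ => ?_)
    simp only [moduli_permIso]
    rw [h.perm a (moduli ψ) (Equiv.swap i j).symm]
    change _ = ‖permIso (Equiv.swap i j) ψ.1 i‖ ^ 2 * _
    rw [permIso_apply, Equiv.symm_swap, Equiv.swap_apply_left,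
      Equiv.swap_apply_of_ne_of_ne hi.symm hj'.symm]
  have h2 : ∑ j, ∫ ψ : PureState d, ‖ψ.1 j‖ ^ 2 * R a (moduli ψ) ∂(haarPure d) = 1 / d := by
    rw [← integral_finsetSum _ fun j _ => h.integrable_sq_mul a j, ← h.integral_eq a]
    refine integral_congr_ae (Filter.Eventually.of_forall fun ψ => ?_)
    simp only [← Finset.sum_mul, sum_norm_sq_pureState, one_mul]
  rw [← Finset.add_sum_erase _ _ (Finset.mem_univ a), Finset.sum_congr rfl h1,
    Finset.sum_const, Finset.card_erase_of_mem (Finset.mem_univ a), Finset.card_univ,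
    Fintype.card_fin, nsmul_eq_mul, Nat.cast_sub (by omega), Nat.cast_one] at h2
  have hd1 : (d : ℝ) - 1 ≠ 0 := by
    have : (2 : ℝ) ≤ d := by exact_mod_cast hd
    linarith
  rw [eq_div_iff hd1]
  linarith

end IsSymmetricResponse

/-! ### Hidden state models with Haar-random pure states -/

/-- The response function of the measurement of the basis `b` with a given profile. -/
noncomputable def profileResponse {d : ℕ} (R : Fin d → (Fin d → ℝ) → ℝ)
    (b : OrthonormalBasis (Fin d) ℂ (EuclideanSpace ℂ (Fin d))) (a : Fin d) (ψ : PureState d) :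
    ℝ :=
  R a (moduli (sphereEquiv b.repr ψ))

theorem moduli_repr {d : ℕ} (b : OrthonormalBasis (Fin d) ℂ (EuclideanSpace ℂ (Fin d)))
    (ψ : PureState d) (k : Fin d) :
    moduli (sphereEquiv b.repr ψ) k = ‖inner ℂ ψ.1 (b k)‖ := by
  change ‖b.repr ψ.1 k‖ = _
  rw [b.repr_apply_apply, norm_inner_symm]

theorem profileResponse_wernerProfile {d : ℕ}
    (b : OrthonormalBasis (Fin d) ℂ (EuclideanSpace ℂ (Fin d))) (a : Fin d) (ψ : PureState d) :
    profileResponse wernerProfile b a ψ = wernerResponse b a ψ := by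
  simp only [profileResponse, wernerProfile, wernerResponse, moduli_repr]
  congr 1
  refine propext ⟨fun h k _ => h k, fun h k => ?_⟩
  by_cases hk : k = a
  · rw [hk]
  · exact h k hk

theorem isResponse_profileResponse {d : ℕ} [NeZero d] {R : Fin d → (Fin d → ℝ) → ℝ}
    (h : IsSymmetricResponse R) (b : OrthonormalBasis (Fin d) ℂ (EuclideanSpace ℂ (Fin d))) :
    IsResponse (haarPure d) Finset.univ (profileResponse R b) := by
  constructor
  · intro a _
    exact (h.meas a).comp (continuous_moduli.comp (sphereEquiv b.repr).continuous).measurable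
  · have := (measurePreserving_sphereEquiv b.repr).quasiMeasurePreserving.ae h.sum_eq_one
    filter_upwards [this] with ψ hψ
    exact ⟨fun a _ => h.nonneg a _, hψ⟩

/-- Unitary invariance, applied to the coordinate map of `b`, reduces every measurement basis to the
standard one. -/
theorem inner_average_profileResponse {d : ℕ} [NeZero d] {R : Fin d → (Fin d → ℝ) → ℝ}
    (h : IsSymmetricResponse R) (b : OrthonormalBasis (Fin d) ℂ (EuclideanSpace ℂ (Fin d)))
    (a i j : Fin d) :
    inner ℂ (b i) (Matrix.toEuclideanLin
      (ensembleAverage (haarPure d) (fun ψ => ketBra ψ.1) (profileResponse R b a)) (b j)) =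
    ∫ ψ : PureState d, (R a (moduli ψ) : ℂ) * (ψ.1 i * star (ψ.1 j)) ∂(haarPure d) := by
  rw [(isEnsemble_haarPure d).inner_ensembleAverage
    ((isResponse_profileResponse h b).integrable (Finset.mem_univ a)),
    ← integral_sphereEquiv b.repr
      fun ψ : PureState d => (R a (moduli ψ) : ℂ) * (ψ.1 i * star (ψ.1 j))]
  refine integral_congr_ae (Filter.Eventually.of_forall fun ψ => ?_)
  change (R a (moduli (sphereEquiv b.repr ψ)) : ℂ) * _ =
    (R a (moduli (sphereEquiv b.repr ψ)) : ℂ) * (b.repr ψ.1 i * star (b.repr ψ.1 j))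
  rw [inner_ketBra, b.repr_apply_apply, b.repr_apply_apply, RCLike.star_def, inner_conj_symm]

theorem integral_mul_star_self {d : ℕ} (R : (Fin d → ℝ) → ℝ) (i : Fin d) :
    ∫ ψ : PureState d, (R (moduli ψ) : ℂ) * (ψ.1 i * star (ψ.1 i)) ∂(haarPure d) =
      ((∫ ψ : PureState d, ‖ψ.1 i‖ ^ 2 * R (moduli ψ) ∂(haarPure d) : ℝ) : ℂ) := by
  rw [← integral_complex_ofReal]
  refine integral_congr_ae (Filter.Eventually.of_forall fun ψ => ?_)
  simp only [RCLike.star_def, Complex.mul_conj, Complex.normSq_eq_norm_sq]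
  push_cast
  ring

/-- A symmetric response function gives a hidden state model of the Werner state as soon as it has
the right second moment. -/
theorem isHaarLHSModel_of_isSymmetricResponse {d : ℕ} [NeZero d] (hd : 2 ≤ d)
    {R : Fin d → (Fin d → ℝ) → ℝ} (h : IsSymmetricResponse R) {η : ℝ}
    (hη : ∀ a, ∫ ψ : PureState d, ‖ψ.1 a‖ ^ 2 * R a (moduli ψ) ∂(haarPure d) =
      (1 - η) / (d : ℝ) ^ 2) :
    IsHaarLHSModel (wernerState d η) (profileResponse R) := by
  refine fun b => ⟨isResponse_profileResponse h b, fun a => matrix_ext_basis b fun i j => ?_⟩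
  have hd' : (2 : ℝ) ≤ d := by exact_mod_cast hd
  have h0 : (d : ℝ) ≠ 0 := by linarith
  have h1 : (d : ℝ) - 1 ≠ 0 := by linarith
  rw [inner_average_profileResponse h, condState_wernerState, trace_ketBra, map_sub,
    LinearMap.sub_apply, inner_sub_right, map_smul, map_smul, map_smul, LinearMap.smul_apply,
    LinearMap.smul_apply, LinearMap.smul_apply, inner_smul_right, inner_smul_right,
    inner_smul_right, inner_ketBra, Matrix.toLpLin_one, LinearMap.id_apply]
  simp only [orthonormal_iff_ite.1 b.orthonormal, OrthonormalBasis.norm_eq_one]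
  by_cases hij : i = j
  · subst hij
    rw [integral_mul_star_self]
    by_cases hi : i = a
    · subst hi
      rw [hη]
      simp only [if_true, mul_one, one_pow, Complex.ofReal_one, ← Complex.ofReal_sub]
      congr 1
      field_simp
      ring
    · rw [h.integral_diag hd hi, hη]
      simp only [if_true, if_neg hi, mul_one, one_pow, Complex.ofReal_one, zero_mul, mul_zero,
        sub_zero]
      congr 1
      field_simp
      ring
  · rw [IsSymmetricResponse.integral_offDiag a hij, if_neg hij]
    by_cases hi : i = a
    · subst hi
      simp [hij]
    · simp [hi]

theorem isSymmetricResponse_wernerProfile (d : ℕ) [NeZero d] :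
    IsSymmetricResponse (wernerProfile (d := d)) where
  meas := measurable_wernerProfile
  nonneg a _ := wernerProfile_nonneg a _
  le_one a _ := wernerProfile_le_one a _
  perm := wernerProfile_comp_perm
  sum_eq_one := ae_sum_wernerProfile d

theorem isSymmetricResponse_bornProfile (d : ℕ) [NeZero d] :
    IsSymmetricResponse (fun (a : Fin d) u => u a ^ 2) where
  meas a := by fun_prop
  nonneg a _ := by positivity
  le_one a ψ := norm_coord_sq_le_one ψ a
  perm _ _ _ := rfl
  sum_eq_one := Filter.Eventually.of_forall fun ψ => sum_norm_sq_pureState ψ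

theorem IsSymmetricResponse.mix {d : ℕ} {R S : Fin d → (Fin d → ℝ) → ℝ}
    (hR : IsSymmetricResponse R) (hS : IsSymmetricResponse S) {t : ℝ} (h0 : 0 ≤ t) (h1 : t ≤ 1) :
    IsSymmetricResponse (fun a u => t * R a u + (1 - t) * S a u) where
  meas a := ((hR.meas a).const_mul _).add ((hS.meas a).const_mul _)
  nonneg a ψ := add_nonneg (mul_nonneg h0 (hR.nonneg a ψ))
    (mul_nonneg (sub_nonneg.2 h1) (hS.nonneg a ψ))
  le_one a ψ := by
    have := mul_le_mul_of_nonneg_left (hR.le_one a ψ) h0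
    have := mul_le_mul_of_nonneg_left (hS.le_one a ψ) (sub_nonneg.2 h1)
    linarith
  perm a u σ := by rw [hR.perm, hS.perm]
  sum_eq_one := by
    filter_upwards [hR.sum_eq_one, hS.sum_eq_one] with ψ h h'
    rw [Finset.sum_add_distrib, ← Finset.mul_sum, ← Finset.mul_sum, h, h']
    ring

theorem isHaarLHSModel_wernerResponse (d : ℕ) (hd : 2 ≤ d) :
    IsHaarLHSModel (wernerState d (1 - 1 / (d : ℝ))) (fun b a ψ => wernerResponse b a ψ) := by
  have : NeZero d := ⟨by omega⟩
  have h := isHaarLHSModel_of_isSymmetricResponse hd (isSymmetricResponse_wernerProfile d)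
    (η := 1 - 1 / (d : ℝ)) fun a => by
      rw [integral_sq_mul_wernerProfile]
      have h0 : (d : ℝ) ≠ 0 := NeZero.ne _
      field_simp
      ring
  have e : profileResponse wernerProfile = fun b (a : Fin d) ψ => wernerResponse b a ψ := by
    ext b a ψ
    exact profileResponse_wernerProfile b a ψ
  rwa [e] at h

/-- The second moment is affine in the mixing weight, so an intermediate value is reached by
interpolation. The upper bound on `η` keeps it above Werner's moment, and positivity of the state
keeps it below the Born moment. -/
theorem exists_isHaarLHSModel (d : ℕ) (hd : 2 ≤ d) (η : ℝ)
    (h1 : -((d : ℝ) - 1) / (d + 1) ≤ η) (h2 : η ≤ 1 - 1 / (d : ℝ)) :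
    ∃ t : ℝ, 0 ≤ t ∧ t ≤ 1 ∧ IsHaarLHSModel (wernerState d η)
      (fun b a ψ => t * wernerResponse b a ψ + (1 - t) * bornResponse b a ψ) := by
  have : NeZero d := ⟨by omega⟩
  have hd' : (2 : ℝ) ≤ d := by exact_mod_cast hd
  -- `x` and `y` are the second moments of Werner's response and of the Born rule; `z` is the one
  -- the Werner state requires.
  set x : ℝ := 1 / (d : ℝ) ^ 3 with hx
  set y : ℝ := 2 / ((d : ℝ) * (d + 1)) with hy
  set z : ℝ := (1 - η) / (d : ℝ) ^ 2 with hz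
  have hzx : x ≤ z := by
    rw [hx, hz, div_le_div_iff₀ (by positivity) (by positivity)]
    have : 1 / (d : ℝ) * d = 1 := by field_simp
    have : 1 ≤ (1 - η) * d := by nlinarith
    nlinarith [sq_nonneg (d : ℝ), mul_le_mul_of_nonneg_left this (sq_nonneg (d : ℝ))]
  have hzy : z ≤ y := by
    rw [hy, hz, div_le_div_iff₀ (by positivity) (by positivity)]
    rw [div_le_iff₀ (by positivity)] at h1
    have : (1 - η) * (d + 1) ≤ 2 * d := by nlinarith
    nlinarith [mul_le_mul_of_nonneg_left this (by positivity : (0 : ℝ) ≤ d)]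
  have hxy : x < y := by
    rw [hx, hy, div_lt_div_iff₀ (by positivity) (by positivity)]
    nlinarith [mul_pos (by positivity : (0 : ℝ) < d) (by linarith : (0 : ℝ) < d - 1),
      mul_nonneg (mul_nonneg (by positivity : (0 : ℝ) ≤ d) (by positivity : (0 : ℝ) ≤ d))
        (by linarith : (0 : ℝ) ≤ d - 2)]
  have hyx : 0 < y - x := sub_pos.2 hxy
  refine ⟨(y - z) / (y - x), div_nonneg (by linarith) hyx.le,
    (div_le_one hyx).2 (by linarith), ?_⟩
  have ht0 : 0 ≤ (y - z) / (y - x) := div_nonneg (by linarith) hyx.le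
  have ht1 : (y - z) / (y - x) ≤ 1 := (div_le_one hyx).2 (by linarith)
  set t := (y - z) / (y - x) with ht
  have htx : t * x + (1 - t) * y = z := by
    rw [ht]; field_simp; ring
  have hW := isSymmetricResponse_wernerProfile d
  have hB := isSymmetricResponse_bornProfile d
  have h := isHaarLHSModel_of_isSymmetricResponse hd (hW.mix hB ht0 ht1) (η := η) fun a => by
    have e : ∀ ψ : PureState d, ‖ψ.1 a‖ ^ 2 *
        (t * wernerProfile a (moduli ψ) + (1 - t) * moduli ψ a ^ 2) =
        t * (‖ψ.1 a‖ ^ 2 * wernerProfile a (moduli ψ)) +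
          (1 - t) * (‖ψ.1 a‖ ^ 2 * ‖ψ.1 a‖ ^ 2) := fun ψ => by
      change _ * (_ + _ * ‖ψ.1 a‖ ^ 2) = _
      ring
    have hB' : Integrable (fun ψ : PureState d => ‖ψ.1 a‖ ^ 2 * ‖ψ.1 a‖ ^ 2) (haarPure d) :=
      hB.integrable_sq_mul a a
    simp only [e]
    rw [integral_add ((hW.integrable_sq_mul a a).const_mul _) (hB'.const_mul _), integral_const_mul, integral_const_mul,
      integral_sq_mul_wernerProfile, integral_pow_four]
    exact htx
  have e : profileResponse (fun (a : Fin d) u => t * wernerProfile a u + (1 - t) * u a ^ 2) =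
      fun b (a : Fin d) ψ => t * wernerResponse b a ψ + (1 - t) * bornResponse b a ψ := by
    ext b a ψ
    rw [← profileResponse_wernerProfile, bornResponse, ← moduli_repr]
    rfl
  rwa [e] at h

/-! ### Expectations in a hidden state ensemble -/

theorem expectation_ketBra {d : ℕ} (ψ v : EuclideanSpace ℂ (Fin d)) :
    expectation (ketBra ψ) v = ‖inner ℂ ψ v‖ ^ 2 := by
  rw [expectation, inner_ketBra, ← inner_conj_symm v ψ, ← Complex.normSq_eq_conj_mul_self,
    Complex.ofReal_re, Complex.normSq_eq_norm_sq]

theorem expectation_spectral {d : ℕ}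
    (b : OrthonormalBasis (Fin d) ℂ (EuclideanSpace ℂ (Fin d))) (c : Fin d → ℝ)
    (v : EuclideanSpace ℂ (Fin d)) :
    expectation (∑ k, (c k : ℂ) • ketBra (b k)) v = ∑ k, c k * ‖inner ℂ (b k) v‖ ^ 2 := by
  have : ∀ k, expectation (ketBra (b k)) v = (inner ℂ (b k) v * inner ℂ v (b k)).re := fun k => by
    rw [expectation, inner_ketBra, mul_comm]
  simp only [← expectation_ketBra, this]
  rw [expectation, inner_spectral, Complex.re_sum]
  simp only [Complex.re_ofReal_mul]

namespace IsDensityMatrix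

variable {d : ℕ} {ρ : Matrix (Fin d) (Fin d) ℂ}

theorem expectation_nonneg (hρ : IsDensityMatrix ρ) (v : EuclideanSpace ℂ (Fin d)) :
    0 ≤ expectation ρ v := by
  obtain ⟨b, c, hc, -, rfl⟩ := hρ.exists_spectral
  rw [expectation_spectral]
  exact Finset.sum_nonneg fun k _ => mul_nonneg (hc k) (by positivity)

theorem expectation_le_one (hρ : IsDensityMatrix ρ) {v : EuclideanSpace ℂ (Fin d)}
    (hv : ‖v‖ = 1) : expectation ρ v ≤ 1 := by
  refine (Complex.re_le_norm _).trans ((hρ.norm_inner_le v v).trans ?_)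
  rw [hv, one_mul]

theorem inner_eq_expectation (hρ : IsDensityMatrix ρ) (v : EuclideanSpace ℂ (Fin d)) :
    inner ℂ v (Matrix.toEuclideanLin ρ v) = (expectation ρ v : ℂ) :=
  ((Matrix.isSymmetric_toEuclideanLin_iff.2 hρ.1.isHermitian).coe_re_inner_self_apply v).symm

theorem sum_expectation (hρ : IsDensityMatrix ρ)
    (b : OrthonormalBasis (Fin d) ℂ (EuclideanSpace ℂ (Fin d))) :
    ∑ k, expectation ρ (b k) = 1 := by
  have h1 : ∑ k, ketBra (b k) = 1 := by
    apply Matrix.toEuclideanLin.injective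
    refine LinearMap.ext fun v => ?_
    rw [map_sum, LinearMap.sum_apply, Matrix.toLpLin_one, LinearMap.id_apply]
    simp only [toEuclideanLin_ketBra]
    exact b.sum_repr' v
  have h2 : ((∑ k, expectation ρ (b k) : ℝ) : ℂ) = 1 := by
    push_cast
    rw [← hρ.2]
    conv_rhs => rw [← Matrix.one_mul ρ, ← h1, Matrix.sum_mul, Matrix.trace_sum]
    refine Finset.sum_congr rfl fun k _ => ?_
    rw [trace_ketBra_mul, hρ.inner_eq_expectation]
  exact_mod_cast h2

theorem iInf_expectation_mem (hρ : IsDensityMatrix ρ) [NeZero d]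
    (b : OrthonormalBasis (Fin d) ℂ (EuclideanSpace ℂ (Fin d))) :
    (⨅ a, expectation ρ (b a)) ∈ Set.Icc 0 1 :=
  ⟨le_ciInf fun _ => hρ.expectation_nonneg _,
    (ciInf_le (Finite.bddBelow_range _) 0).trans (hρ.expectation_le_one (b.norm_eq_one 0))⟩

end IsDensityMatrix

namespace IsEnsemble

variable {Ξ : Type u} [MeasurableSpace Ξ] {d : ℕ} {μ : Measure Ξ}
  {ρ : Ξ → Matrix (Fin d) (Fin d) ℂ}

theorem measurable_expectation (h : IsEnsemble μ ρ) (v : EuclideanSpace ℂ (Fin d)) :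
    Measurable fun ξ => expectation (ρ ξ) v :=
  Complex.measurable_re.comp (h.measurable_inner v v)

theorem integrable_expectation (h : IsEnsemble μ ρ) {p : Ξ → ℝ} (hp : Integrable p μ)
    (v : EuclideanSpace ℂ (Fin d)) : Integrable (fun ξ => p ξ * expectation (ρ ξ) v) μ := by
  have := (h.integrable_mul_inner hp v v).re
  refine this.congr (Filter.Eventually.of_forall fun ξ => ?_)
  exact Complex.re_ofReal_mul _ _

theorem inner_ensembleAverage_self (h : IsEnsemble μ ρ) {p : Ξ → ℝ} (hp : Integrable p μ)
    (v : EuclideanSpace ℂ (Fin d)) :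
    inner ℂ v (Matrix.toEuclideanLin (ensembleAverage μ ρ p) v) =
      ((∫ ξ, p ξ * expectation (ρ ξ) v ∂μ : ℝ) : ℂ) := by
  rw [h.inner_ensembleAverage hp, ← integral_complex_ofReal]
  refine integral_congr_ae (Filter.Eventually.of_forall fun ξ => ?_)
  simp only [(h.state ξ).inner_eq_expectation]
  push_cast
  rfl

theorem expectation_ensembleAverage (h : IsEnsemble μ ρ) {p : Ξ → ℝ} (hp : Integrable p μ)
    (v : EuclideanSpace ℂ (Fin d)) :
    expectation (ensembleAverage μ ρ p) v = ∫ ξ, p ξ * expectation (ρ ξ) v ∂μ := by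
  rw [expectation, h.inner_ensembleAverage_self hp, Complex.ofReal_re]

/-- However Alice responds, the results cannot be rarer than in the least likely direction. -/
theorem integral_iInf_le_sum_expectation [NeZero d] (h : IsEnsemble μ ρ) {p : Fin d → Ξ → ℝ}
    (hp : IsResponse μ Finset.univ p)
    (b : OrthonormalBasis (Fin d) ℂ (EuclideanSpace ℂ (Fin d))) :
    ∫ ξ, ⨅ a, expectation (ρ ξ) (b a) ∂μ ≤
      ∑ a, expectation (ensembleAverage μ ρ (p a)) (b a) := by
  have := h.prob
  have hint : ∀ a, Integrable (p a) μ := fun a => hp.integrable (Finset.mem_univ a)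
  simp only [fun a => h.expectation_ensembleAverage (hint a) (b a)]
  rw [← integral_finsetSum _ fun a _ => h.integrable_expectation (hint a) (b a)]
  refine integral_mono_ae ?_
    (integrable_finsetSum _ fun a _ => h.integrable_expectation (hint a) (b a)) ?_
  · refine Integrable.of_bound (Measurable.iInf fun a =>
      h.measurable_expectation (b a)).aestronglyMeasurable 1 (Filter.Eventually.of_forall fun ξ => ?_)
    rw [Real.norm_of_nonneg ((h.state ξ).iInf_expectation_mem b).1]
    exact ((h.state ξ).iInf_expectation_mem b).2
  · filter_upwards [hp.2] with ξ hξ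
    calc ⨅ a, expectation (ρ ξ) (b a) = ∑ a, p a ξ * ⨅ a, expectation (ρ ξ) (b a) := by
          rw [← Finset.sum_mul, hξ.2, one_mul]
      _ ≤ ∑ a, p a ξ * expectation (ρ ξ) (b a) := Finset.sum_le_sum fun a ha =>
          mul_le_mul_of_nonneg_left (ciInf_le (Finite.bddBelow_range _) a) (hξ.1 a ha)

end IsEnsemble

/-- The mean of the smallest Born probability of a Haar-random pure state. -/
theorem integral_iInf_norm_sq (d : ℕ) [NeZero d] :
    ∫ ψ : PureState d, ⨅ a, ‖ψ.1 a‖ ^ 2 ∂(haarPure d) = 1 / (d : ℝ) ^ 2 := by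
  -- Almost surely exactly one outcome is minimal, so the minimum is a sum of `d` terms of mean
  -- `1/d³`.
  have h1 : (fun ψ : PureState d => ⨅ a, ‖ψ.1 a‖ ^ 2) =ᵐ[haarPure d]
      fun ψ => ∑ a, ‖ψ.1 a‖ ^ 2 * wernerProfile a (moduli ψ) := by
    filter_upwards [ae_sum_wernerProfile d] with ψ hψ
    have h2 : ∀ a, ‖ψ.1 a‖ ^ 2 * wernerProfile a (moduli ψ) =
        (⨅ a, ‖ψ.1 a‖ ^ 2) * wernerProfile a (moduli ψ) := by
      intro a
      unfold wernerProfile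
      split_ifs with h
      · congr 1
        refine le_antisymm (le_ciInf fun k => ?_) (ciInf_le (Finite.bddBelow_range _) a)
        exact pow_le_pow_left₀ (norm_nonneg _) (h k) 2
      · simp
    rw [Finset.sum_congr rfl fun a _ => h2 a, ← Finset.mul_sum, hψ, mul_one]
  rw [integral_congr_ae h1, integral_finsetSum _ fun a _ =>
    (isSymmetricResponse_wernerProfile d).integrable_sq_mul a a]
  have hd : (d : ℝ) ≠ 0 := NeZero.ne _
  simp only [integral_sq_mul_wernerProfile]
  simp
  field_simp

/-- The general bound by the mean of the minimum, evaluated for the Haar ensemble after rotating `b`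
to the standard basis. -/
theorem haar_response_bound (d : ℕ) [NeZero d]
    (b : OrthonormalBasis (Fin d) ℂ (EuclideanSpace ℂ (Fin d))) {p : Fin d → PureState d → ℝ}
    (hp : IsResponse (haarPure d) Finset.univ p) :
    1 / (d : ℝ) ^ 3 ≤ (1 / (d : ℝ)) * ∑ a, expectation
      (ensembleAverage (haarPure d) (fun ψ => ketBra ψ.1) (p a)) (b a) := by
  have h := (isEnsemble_haarPure d).integral_iInf_le_sum_expectation hp b
  have h2 : ∫ ψ : PureState d, ⨅ a, expectation (ketBra ψ.1) (b a) ∂(haarPure d) =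
      1 / (d : ℝ) ^ 2 := by
    rw [← integral_iInf_norm_sq, ← integral_sphereEquiv b.repr
      fun ψ : PureState d => ⨅ a, ‖ψ.1 a‖ ^ 2]
    refine integral_congr_ae (Filter.Eventually.of_forall fun ψ => ?_)
    refine iInf_congr fun a => ?_
    rw [expectation_ketBra, ← moduli_repr]
    rfl
  rw [h2] at h
  have hd : (d : ℝ) ≠ 0 := NeZero.ne _
  calc 1 / (d : ℝ) ^ 3 = 1 / d * (1 / (d : ℝ) ^ 2) := by field_simp
    _ ≤ _ := mul_le_mul_of_nonneg_left h (by positivity)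

theorem expectation_wernerResponse (d : ℕ) [NeZero d]
    (b : OrthonormalBasis (Fin d) ℂ (EuclideanSpace ℂ (Fin d))) (a : Fin d) :
    expectation (ensembleAverage (haarPure d) (fun ψ => ketBra ψ.1) (wernerResponse b a)) (b a) =
      1 / (d : ℝ) ^ 3 := by
  have e : wernerResponse b a = profileResponse wernerProfile b a := by
    ext ψ
    exact (profileResponse_wernerProfile b a ψ).symm
  rw [e, expectation, inner_average_profileResponse (isSymmetricResponse_wernerProfile d),
    integral_mul_star_self, Complex.ofReal_re, integral_sq_mul_wernerProfile]

/-! ### From rank-one measurements to all observables, and to hidden variable models -/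

theorem ensembleAverage_sum {Ξ : Type u} [MeasurableSpace Ξ] {d : ℕ} {α : Type} {μ : Measure Ξ}
    {ρ : Ξ → Matrix (Fin d) (Fin d) ℂ} (h : IsEnsemble μ ρ) (s : Finset α) {p : α → Ξ → ℝ}
    (hp : ∀ i ∈ s, Integrable (p i) μ) :
    ensembleAverage μ ρ (fun ξ => ∑ i ∈ s, p i ξ) = ∑ i ∈ s, ensembleAverage μ ρ (p i) := by
  refine matrix_ext_basis (EuclideanSpace.basisFun (Fin d) ℂ) fun j k => ?_
  rw [h.inner_ensembleAverage (integrable_finsetSum _ hp), map_sum, LinearMap.sum_apply, inner_sum,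
    Finset.sum_congr rfl fun i hi => h.inner_ensembleAverage (hp i hi) _ _,
    ← integral_finsetSum _ fun i hi => h.integrable_mul_inner (hp i hi) _ _]
  simp only [Complex.ofReal_sum, Finset.sum_mul]

/-- A degenerate observable is measured in an eigenbasis, and the responses of equal eigenvalues are
added; conditional states are additive in the projector. -/
theorem IsHaarLHSModel.isLHSEnsembleFor {d : ℕ} [NeZero d]
    {W : Matrix (Fin d × Fin d) (Fin d × Fin d) ℂ}
    {p : OrthonormalBasis (Fin d) ℂ (EuclideanSpace ℂ (Fin d)) → Fin d → PureState d → ℝ}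
    (h : IsHaarLHSModel W p) (M : Set (Observable (Fin d))) :
    IsLHSEnsembleFor M W (haarPure d) (fun ψ => ketBra ψ.1) := by
  refine ⟨isEnsemble_haarPure d, fun A _ => ?_⟩
  obtain ⟨hr, hW⟩ := h A.2.eigenvectorBasis
  refine ⟨fun a ψ => ∑ i with A.2.eigenvalues i = a, p A.2.eigenvectorBasis i ψ, ⟨?_, ?_⟩, ?_⟩
  · exact fun a _ => Finset.measurable_sum _ fun i _ => hr.1 i (Finset.mem_univ i)
  · filter_upwards [hr.2] with ψ hψ
    refine ⟨fun a _ => Finset.sum_nonneg fun i _ => hψ.1 i (Finset.mem_univ i), ?_⟩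
    exact (Finset.sum_fiberwise_of_maps_to (fun i _ =>
      Finset.mem_image_of_mem A.2.eigenvalues (Finset.mem_univ i)) _).trans hψ.2
  · intro a _
    rw [projector_eq_sum A _ _ (toEuclideanLin_eigenvectorBasis A), condState_sum,
      ensembleAverage_sum (isEnsemble_haarPure d) _
        fun i _ => hr.integrable (Finset.mem_univ i)]
    exact Finset.sum_congr rfl fun i _ => hW i

/-- Alice keeps her response, and Bob answers with the quantum probabilities of his hidden state `ρ
ξ`. -/
theorem IsLHSEnsembleFor.hasLHVModel {Ξ : Type u} [MeasurableSpace Ξ] {d : ℕ}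
    {M : Set (Observable (Fin d))} {W : Matrix (Fin d × Fin d) (Fin d × Fin d) ℂ}
    {μ : Measure Ξ} {ρ : Ξ → Matrix (Fin d) (Fin d) ℂ} (h : IsLHSEnsembleFor M W μ ρ)
    (N : Set (Observable (Fin d))) : HasLHVModel.{u} M N W := by
  classical
  obtain ⟨hE, hM⟩ := h
  have := hE.prob
  choose! p hp using hM
  refine ⟨Ξ, inferInstance, μ, p,
    fun B b ξ => ∑ i with B.2.eigenvalues i = b, expectation (ρ ξ) (B.2.eigenvectorBasis i),
    hE.prob, fun A hA => (hp A hA).1, fun B _ => ⟨?_, ?_⟩, ?_⟩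
  · exact fun b _ => Finset.measurable_sum _ fun i _ => hE.measurable_expectation _
  · refine Filter.Eventually.of_forall fun ξ => ⟨fun b _ => Finset.sum_nonneg fun i _ =>
      (hE.state ξ).expectation_nonneg _, ?_⟩
    exact (Finset.sum_fiberwise_of_maps_to (fun i _ =>
      Finset.mem_image_of_mem B.2.eigenvalues (Finset.mem_univ i)) _).trans
      ((hE.state ξ).sum_expectation _)
  · intro A hA B _ a ha b _
    have hint := (hp A hA).1.integrable ha
    rw [trace_kronecker_mul, (hp A hA).2 a ha,
      projector_eq_sum B _ _ (toEuclideanLin_eigenvectorBasis B), Matrix.sum_mul,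
      Matrix.trace_sum]
    simp only [trace_ketBra_mul, hE.inner_ensembleAverage_self hint, Finset.mul_sum]
    rw [integral_finsetSum _ fun i _ => hE.integrable_expectation hint _]
    push_cast
    rfl

/-- Steering and Bell nonlocality quantify over hidden variables in `Type u`, whereas the pure
states form a `Type`. -/
theorem IsLHSEnsembleFor.ulift {Ξ : Type} [MeasurableSpace Ξ] {d : ℕ}
    {M : Set (Observable (Fin d))} {W : Matrix (Fin d × Fin d) (Fin d × Fin d) ℂ}
    {μ : Measure Ξ} {ρ : Ξ → Matrix (Fin d) (Fin d) ℂ} (h : IsLHSEnsembleFor M W μ ρ) :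
    IsLHSEnsembleFor M W (μ.map (MeasurableEquiv.ulift.{0, u}.symm)) (fun ξ => ρ ξ.down) := by
  obtain ⟨hE, hM⟩ := h
  have := hE.prob
  refine ⟨⟨Measure.isProbabilityMeasure_map MeasurableEquiv.ulift.symm.measurable.aemeasurable,
    fun i j => (hE.meas i j).comp MeasurableEquiv.ulift.measurable, fun ξ => hE.state ξ.down⟩,
    fun A hA => ?_⟩
  obtain ⟨p, hp, hW⟩ := hM A hA
  refine ⟨fun a ξ => p a ξ.down, ⟨fun a ha => (hp.1 a ha).comp MeasurableEquiv.ulift.measurable,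
    ?_⟩, fun a ha => ?_⟩
  · rw [MeasurableEquiv.ulift.symm.measurableEmbedding.ae_map_iff]
    exact hp.2
  · rw [hW a ha]
    ext i j
    exact (MeasurableEquiv.ulift.symm.measurableEmbedding.integral_map
      fun ξ : ULift.{u} Ξ => (p a ξ.down : ℂ) * ρ ξ.down i j).symm

/-! ### Averaging over the unitary group -/

instance continuousStar_endomorphism (d : ℕ) :
    ContinuousStar (EuclideanSpace ℂ (Fin d) →L[ℂ] EuclideanSpace ℂ (Fin d)) :=
  ⟨(ContinuousLinearMap.adjoint (𝕜 := ℂ) (E := EuclideanSpace ℂ (Fin d))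
    (F := EuclideanSpace ℂ (Fin d))).continuous⟩

/-- The group of unitary operators of `ℂ^d`. -/
def UnitaryOp (d : ℕ) : Type :=
  unitary (EuclideanSpace ℂ (Fin d) →L[ℂ] EuclideanSpace ℂ (Fin d))

noncomputable instance group_unitaryOp (d : ℕ) : Group (UnitaryOp d) :=
  inferInstanceAs
    (Group (unitary (EuclideanSpace ℂ (Fin d) →L[ℂ] EuclideanSpace ℂ (Fin d))))

instance topologicalSpace_unitaryOp (d : ℕ) : TopologicalSpace (UnitaryOp d) :=
  inferInstanceAs
    (TopologicalSpace (unitary (EuclideanSpace ℂ (Fin d) →L[ℂ] EuclideanSpace ℂ (Fin d))))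

instance isTopologicalGroup_unitaryOp (d : ℕ) : IsTopologicalGroup (UnitaryOp d) :=
  inferInstanceAs
    (IsTopologicalGroup (unitary (EuclideanSpace ℂ (Fin d) →L[ℂ] EuclideanSpace ℂ (Fin d))))

instance compactSpace_unitaryOp (d : ℕ) : CompactSpace (UnitaryOp d) := by
  have : ProperSpace (EuclideanSpace ℂ (Fin d) →L[ℂ] EuclideanSpace ℂ (Fin d)) :=
    FiniteDimensional.proper ℂ _
  refine isCompact_iff_compactSpace.1 (Metric.isCompact_of_isClosed_isBounded isClosed_unitary ?_)
  refine (Metric.isBounded_closedBall (x := 0) (r := 1)).subset fun U hU => ?_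
  rw [mem_closedBall_zero_iff]
  refine ContinuousLinearMap.opNorm_le_bound _ zero_le_one fun x => ?_
  rw [ContinuousLinearMap.norm_map_of_mem_unitary hU, one_mul]

instance measurableSpace_unitaryOp (d : ℕ) : MeasurableSpace (UnitaryOp d) := borel _

instance borelSpace_unitaryOp (d : ℕ) : BorelSpace (UnitaryOp d) := ⟨rfl⟩

/-- Unitary operators as linear isometries. -/
noncomputable def UnitaryOp.toIso {d : ℕ} :
    UnitaryOp d ≃* (EuclideanSpace ℂ (Fin d) ≃ₗᵢ[ℂ] EuclideanSpace ℂ (Fin d)) :=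
  Unitary.linearIsometryEquiv

theorem UnitaryOp.toIso_mul_apply {d : ℕ} (U V : UnitaryOp d) (z : EuclideanSpace ℂ (Fin d)) :
    UnitaryOp.toIso (U * V) z = UnitaryOp.toIso U (UnitaryOp.toIso V z) := by
  rw [map_mul]
  rfl

theorem UnitaryOp.continuous_toIso (d : ℕ) :
    Continuous fun q : UnitaryOp d × EuclideanSpace ℂ (Fin d) => UnitaryOp.toIso q.1 q.2 :=
  (continuous_subtype_val.comp continuous_fst).clm_apply continuous_snd

/-- The normalized Haar measure of the unitary group. -/
noncomputable def haarUnitary (d : ℕ) : Measure (UnitaryOp d) := Measure.haarMeasure ⊤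

instance isHaarMeasure_haarUnitary (d : ℕ) : (haarUnitary d).IsHaarMeasure := by
  unfold haarUnitary; infer_instance

instance isProbabilityMeasure_haarUnitary (d : ℕ) : IsProbabilityMeasure (haarUnitary d) :=
  ⟨Measure.haarMeasure_self (K₀ := (⊤ : TopologicalSpace.PositiveCompacts (UnitaryOp d)))⟩

/-- Transitivity of the unitary group on the sphere: both vectors extend to orthonormal bases, and
one basis is mapped to the other. -/
theorem exists_isometry_map_eq {d : ℕ} [NeZero d] {v w : EuclideanSpace ℂ (Fin d)} (hv : ‖v‖ = 1)
    (hw : ‖w‖ = 1) :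
    ∃ φ : EuclideanSpace ℂ (Fin d) ≃ₗᵢ[ℂ] EuclideanSpace ℂ (Fin d), φ v = w := by
  have key : ∀ {v : EuclideanSpace ℂ (Fin d)}, ‖v‖ = 1 →
      ∃ b : OrthonormalBasis (Fin d) ℂ (EuclideanSpace ℂ (Fin d)), b 0 = v := fun {v} hv => by
    obtain ⟨b, hb⟩ := Orthonormal.exists_orthonormalBasis_extension_of_card_eq (𝕜 := ℂ)
      (ι := Fin d) (by simp) (v := fun _ => v) (s := {0})
      (by
        rw [orthonormal_iff_ite]
        rintro ⟨i, rfl⟩ ⟨j, rfl⟩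
        simp [hv])
    exact ⟨b, hb 0 rfl⟩
  obtain ⟨b, rfl⟩ := key hv
  obtain ⟨c, rfl⟩ := key hw
  exact ⟨b.equiv c (Equiv.refl _), by simp⟩

/-- A random rotation of a fixed pure state is Haar-random. -/
theorem integral_haarUnitary {d : ℕ} [NeZero d] {f : EuclideanSpace ℂ (Fin d) → ℝ}
    (hf : Continuous f) {v : EuclideanSpace ℂ (Fin d)} (hv : ‖v‖ = 1) :
    ∫ U : UnitaryOp d, f (UnitaryOp.toIso U⁻¹ v) ∂(haarUnitary d) =
      ∫ ψ : PureState d, f ψ.1 ∂(haarPure d) := by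
  have h1 : ∀ ψ : PureState d, ∫ U : UnitaryOp d, f (UnitaryOp.toIso U⁻¹ ψ.1) ∂(haarUnitary d) =
      ∫ U : UnitaryOp d, f (UnitaryOp.toIso U⁻¹ v) ∂(haarUnitary d) := by
    intro ψ
    obtain ⟨φ, hφ⟩ := exists_isometry_map_eq hv (norm_eq_of_mem_sphere ψ)
    obtain ⟨V, rfl⟩ := UnitaryOp.toIso.surjective φ
    -- Left translation by `V` turns `U⁻¹ ψ` into `U⁻¹ V⁻¹ ψ = U⁻¹ v`; the inverse in the statement
    -- is what lets left invariance suffice.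
    rw [← integral_mul_left_eq_self (fun U : UnitaryOp d => f (UnitaryOp.toIso U⁻¹ ψ.1)) V]
    refine integral_congr_ae (Filter.Eventually.of_forall fun U => ?_)
    have : UnitaryOp.toIso (V * U)⁻¹ ψ.1 = UnitaryOp.toIso U⁻¹ v := by
      rw [← hφ, ← UnitaryOp.toIso_mul_apply, _root_.mul_inv_rev,
        inv_mul_cancel_right]
    simp only [this]
  have h2 : ∀ U : UnitaryOp d, ∫ ψ : PureState d, f (UnitaryOp.toIso U⁻¹ ψ.1) ∂(haarPure d) =
      ∫ ψ : PureState d, f ψ.1 ∂(haarPure d) := fun U =>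
    integral_sphereEquiv (UnitaryOp.toIso U⁻¹) fun ψ : PureState d => f ψ.1
  have hcs : CompactSpace (PureState d) := isCompact_iff_compactSpace.1 (isCompact_sphere _ _)
  have hcont : Continuous fun q : UnitaryOp d × PureState d => f (UnitaryOp.toIso q.1⁻¹ q.2.1) :=
    hf.comp ((UnitaryOp.continuous_toIso d).comp
      (continuous_fst.inv.prodMk (continuous_subtype_val.comp continuous_snd)))
  have hint : Integrable (fun q : UnitaryOp d × PureState d => f (UnitaryOp.toIso q.1⁻¹ q.2.1))
      ((haarUnitary d).prod (haarPure d)) :=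
    hcont.integrable_of_hasCompactSupport (HasCompactSupport.of_compactSpace _)
  -- In the double average over `U` and `ψ`, the integral over `U` does not depend on `ψ`, nor the
  -- one over `ψ` on `U`.
  have h3 := integral_integral_swap (f := fun (U : UnitaryOp d) (ψ : PureState d) =>
    f (UnitaryOp.toIso U⁻¹ ψ.1)) hint
  simp only [h1, h2] at h3
  simpa using h3.symm

/-- The orthonormal basis obtained by a unitary rotation of the standard basis. -/
noncomputable def rotatedBasis {d : ℕ} (U : UnitaryOp d) :
    OrthonormalBasis (Fin d) ℂ (EuclideanSpace ℂ (Fin d)) :=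
  (EuclideanSpace.basisFun (Fin d) ℂ).map (UnitaryOp.toIso U)

theorem rotatedBasis_apply {d : ℕ} (U : UnitaryOp d) (a : Fin d) :
    rotatedBasis U a = UnitaryOp.toIso U (EuclideanSpace.single a 1) := by
  simp [rotatedBasis]

theorem norm_inner_rotatedBasis {d : ℕ} (U : UnitaryOp d) (a : Fin d)
    (v : EuclideanSpace ℂ (Fin d)) :
    ‖inner ℂ v (rotatedBasis U a)‖ = ‖UnitaryOp.toIso U⁻¹ v a‖ := by
  have h := (UnitaryOp.toIso U⁻¹).inner_map_map v (rotatedBasis U a)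
  rw [rotatedBasis_apply] at h ⊢
  rw [← h, ← UnitaryOp.toIso_mul_apply, inv_mul_cancel, map_one]
  simp [EuclideanSpace.inner_single_right]

theorem continuous_iInf_norm_sq (d : ℕ) [NeZero d] :
    Continuous fun z : EuclideanSpace ℂ (Fin d) => ⨅ a, ‖z a‖ ^ 2 := by
  have : (fun z : EuclideanSpace ℂ (Fin d) => ⨅ a, ‖z a‖ ^ 2) = fun z =>
      Finset.univ.inf' Finset.univ_nonempty fun a => ‖z a‖ ^ 2 := by
    ext z
    rw [Finset.inf'_univ_eq_ciInf]
  rw [this]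
  exact Continuous.finset_inf'_apply _ fun a _ => by fun_prop

theorem measurable_expectation_rotatedBasis {Ξ : Type u} [MeasurableSpace Ξ] {d : ℕ}
    {μ : Measure Ξ} {ρ : Ξ → Matrix (Fin d) (Fin d) ℂ} (h : IsEnsemble μ ρ) (a : Fin d) :
    Measurable fun q : UnitaryOp d × Ξ => expectation (ρ q.2) (rotatedBasis q.1 a) := by
  simp only [expectation, inner_toEuclideanLin_eq_sum, rotatedBasis_apply]
  have hc : ∀ i, Measurable fun q : UnitaryOp d × Ξ =>
      UnitaryOp.toIso q.1 (EuclideanSpace.single a 1) i := fun i => by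
    have : Continuous fun U : UnitaryOp d => UnitaryOp.toIso U (EuclideanSpace.single a 1) i :=
      (PiLp.continuous_apply 2 _ i).comp
        ((UnitaryOp.continuous_toIso d).comp (continuous_id.prodMk continuous_const))
    exact this.measurable.comp measurable_fst
  refine Complex.measurable_re.comp (Finset.measurable_sum _ fun i _ =>
    Finset.measurable_sum _ fun j _ => ?_)
  exact ((continuous_star.measurable.comp (hc i)).mul ((h.meas i j).comp measurable_snd)).mul (hc j)

/-- In a random orthonormal basis the smallest diagonal element of a density matrix is on average
at least that of a pure state. -/
theorem IsDensityMatrix.le_integral_iInf_expectation {d : ℕ} [NeZero d]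
    {ρ : Matrix (Fin d) (Fin d) ℂ} (hρ : IsDensityMatrix ρ)
    (hm : Measurable fun U : UnitaryOp d => ⨅ a, expectation ρ (rotatedBasis U a)) :
    1 / (d : ℝ) ^ 2 ≤ ∫ U : UnitaryOp d, ⨅ a, expectation ρ (rotatedBasis U a) ∂(haarUnitary d) := by
  obtain ⟨b, c, hc, hs, hb⟩ := hρ.exists_spectral
  set g : EuclideanSpace ℂ (Fin d) → ℝ := fun z => ⨅ a, ‖z a‖ ^ 2 with hg
  have hgc : Continuous g := continuous_iInf_norm_sq d
  have hint : ∀ k, Integrable (fun U : UnitaryOp d => c k * g (UnitaryOp.toIso U⁻¹ (b k))) (haarUnitary d) := fun k => by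
    refine Integrable.const_mul ?_ _
    refine Continuous.integrable_of_hasCompactSupport ?_ (HasCompactSupport.of_compactSpace _)
    exact hgc.comp ((UnitaryOp.continuous_toIso d).comp (continuous_inv.prodMk continuous_const))
  calc 1 / (d : ℝ) ^ 2 = ∑ k, c k * (1 / (d : ℝ) ^ 2) := by rw [← Finset.sum_mul, hs, one_mul]
    _ = ∫ U : UnitaryOp d, ∑ k, c k * g (UnitaryOp.toIso U⁻¹ (b k)) ∂(haarUnitary d) := by
        rw [integral_finsetSum _ fun k _ => hint k]
        refine Finset.sum_congr rfl fun k _ => ?_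
        rw [integral_const_mul, integral_haarUnitary hgc (b.norm_eq_one k), integral_iInf_norm_sq]
    _ ≤ _ := by
        refine integral_mono (integrable_finsetSum _ fun k _ => hint k) ?_ fun U => ?_
        · refine Integrable.of_bound hm.aestronglyMeasurable 1
            (Filter.Eventually.of_forall fun U => ?_)
          rw [Real.norm_of_nonneg (hρ.iInf_expectation_mem _).1]
          exact (hρ.iInf_expectation_mem _).2
        -- Concavity of the minimum: each diagonal entry of the mixture dominates the mixture of the
        -- minima of its eigenvectors.
        · refine le_ciInf fun a => ?_
          rw [hb, expectation_spectral]
          refine Finset.sum_le_sum fun k _ => mul_le_mul_of_nonneg_left ?_ (hc k)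
          rw [norm_inner_rotatedBasis]
          exact ciInf_le (Finite.bddBelow_range _) a

/-- Fubini: `A` and `B` bound the same double integral. In the application, `x` is the random basis
and `y` the hidden variable. -/
theorem le_of_forall_integral_le {X : Type*} {Y : Type*} [MeasurableSpace X] [MeasurableSpace Y]
    {ν : Measure X} {μ : Measure Y} [IsProbabilityMeasure ν] [IsProbabilityMeasure μ]
    {F : X × Y → ℝ} (hF : Integrable F (ν.prod μ)) {A B : ℝ} (hA : ∀ y, A ≤ ∫ x, F (x, y) ∂ν)
    (hB : ∀ x, ∫ y, F (x, y) ∂μ ≤ B) : A ≤ B :=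
  calc A = ∫ _, A ∂μ := by simp
    _ ≤ ∫ y, ∫ x, F (x, y) ∂ν ∂μ :=
        integral_mono (integrable_const _) hF.integral_prod_right hA
    _ = ∫ x, ∫ y, F (x, y) ∂μ ∂ν := (integral_integral_swap (f := fun x y => F (x, y)) hF).symm
    _ ≤ ∫ _, B ∂ν := integral_mono hF.integral_prod_left (integrable_const _) hB
    _ = B := by simp

/-- A hidden state model of the Werner state for all rank-one measurements bounds the parameter. -/
theorem IsLHSEnsembleFor.wernerState_le {Ξ : Type u} [MeasurableSpace Ξ] {d : ℕ} (hd : 2 ≤ d)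
    {η : ℝ} {μ : Measure Ξ} {ρ : Ξ → Matrix (Fin d) (Fin d) ℂ}
    (h : IsLHSEnsembleFor Set.univ (wernerState d η) μ ρ) : η ≤ 1 - 1 / (d : ℝ) := by
  have : NeZero d := ⟨by omega⟩
  obtain ⟨hE, hM⟩ := h
  have := hE.prob
  have hd' : (2 : ℝ) ≤ d := by exact_mod_cast hd
  have h0 : (0 : ℝ) < d := by linarith
  have h1 : (d : ℝ) - 1 ≠ 0 := by linarith
  have hU : ∀ U : UnitaryOp d,
      ∫ ξ, ⨅ a, expectation (ρ ξ) (rotatedBasis U a) ∂μ ≤ (1 - η) / d := by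
    intro U
    set b := rotatedBasis U
    -- Any distinct eigenvalues would do; they make the observable nondegenerate, so its projectors
    -- are the `|a⟩⟨a|`.
    set e : Fin d → ℝ := fun i => (i : ℕ) with he
    have hinj : Function.Injective e := fun i j hij => Fin.ext (Nat.cast_injective (R := ℝ) hij)
    have hA := toEuclideanLin_basisObservable b e
    obtain ⟨p, hp, hW⟩ := hM (basisObservable b e) (Set.mem_univ _)
    rw [outcomes_eq_image _ b e hA] at hp hW
    have hr : IsResponse μ Finset.univ fun i => p (e i) := by
      refine ⟨fun i _ => hp.1 _ (Finset.mem_image_of_mem e (Finset.mem_univ i)), ?_⟩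
      filter_upwards [hp.2] with ξ hξ
      refine ⟨fun i _ => hξ.1 _ (Finset.mem_image_of_mem e (Finset.mem_univ i)), ?_⟩
      rw [← hξ.2, Finset.sum_image hinj.injOn]
    refine (hE.integral_iInf_le_sum_expectation hr b).trans_eq ?_
    have hval : ∀ a, expectation (ensembleAverage μ ρ (p (e a))) (b a) = (1 - η) / (d : ℝ) ^ 2 := by
      intro a
      rw [← hW _ (Finset.mem_image_of_mem e (Finset.mem_univ a)), projector_eq_sum _ b e hA]
      simp only [hinj.eq_iff, Finset.filter_eq', Finset.mem_univ, if_true, Finset.sum_singleton]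
      rw [expectation, condState_wernerState, trace_ketBra, b.norm_eq_one, map_sub,
        LinearMap.sub_apply, inner_sub_right, map_smul, map_smul, map_smul, LinearMap.smul_apply,
        LinearMap.smul_apply, LinearMap.smul_apply, inner_smul_right, inner_smul_right,
        inner_smul_right, inner_ketBra, Matrix.toLpLin_one, LinearMap.id_apply,
        inner_self_eq_norm_sq_to_K, b.norm_eq_one]
      have : ((((d - 1 + η) / (d - 1) * (1 / d ^ 2) : ℝ) : ℂ) - ((η / (d - 1) * (1 / d) : ℝ) : ℂ)).re
          = (1 - η) / (d : ℝ) ^ 2 := by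
        rw [← Complex.ofReal_sub, Complex.ofReal_re]
        field_simp
        ring
      simpa using this
    rw [Finset.sum_congr rfl fun a _ => hval a]
    simp
    field_simp
  have hmeas : Measurable fun q : UnitaryOp d × Ξ =>
      ⨅ a, expectation (ρ q.2) (rotatedBasis q.1 a) :=
    Measurable.iInf fun a => measurable_expectation_rotatedBasis hE a
  have hint : Integrable (fun q : UnitaryOp d × Ξ =>
      ⨅ a, expectation (ρ q.2) (rotatedBasis q.1 a)) ((haarUnitary d).prod μ) := by
    refine Integrable.of_bound hmeas.aestronglyMeasurable 1 (Filter.Eventually.of_forall fun q => ?_)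
    rw [Real.norm_of_nonneg ((hE.state q.2).iInf_expectation_mem _).1]
    exact ((hE.state q.2).iInf_expectation_mem _).2
  have hle : 1 / (d : ℝ) ^ 2 ≤ (1 - η) / d := by
    refine le_of_forall_integral_le hint (fun ξ => ?_) hU
    have hm := hmeas.comp (measurable_prodMk_right (α := UnitaryOp d) (y := ξ))
    exact (hE.state ξ).le_integral_iInf_expectation hm
  rw [div_le_div_iff₀ (by positivity) h0] at hle
  have : 1 / (d : ℝ) ≤ 1 - η := by
    rw [div_le_iff₀ h0]
    nlinarith
  linarith

end Steering

/-! ### The steering threshold -/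

theorem mainTheorem1 (d : ℕ) (hd : 2 ≤ d) :
    -- the range of the parameter
    (∀ η : ℝ, Steering.IsDensityMatrix (Steering.wernerState d η) ↔
      -((d : ℝ) - 1) / (d + 1) ≤ η ∧ η ≤ 1) ∧
    -- the steering threshold
    (∀ η : ℝ, Steering.IsDensityMatrix (Steering.wernerState d η) →
      (Steering.Steerable.{u} (Steering.wernerState d η) ↔ 1 - 1 / (d : ℝ) < η)) ∧
    -- Haar-random pure states are local hidden states for all projective measurements up to the
    -- threshold, where there is no Bell nonlocality either
    (∀ η : ℝ, Steering.IsDensityMatrix (Steering.wernerState d η) → η ≤ 1 - 1 / (d : ℝ) →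
      Steering.IsLHSEnsembleFor Set.univ (Steering.wernerState d η)
        (Steering.haarPure d) (fun ψ => Steering.ketBra ψ.1) ∧
      (∃ t : ℝ, 0 ≤ t ∧ t ≤ 1 ∧ Steering.IsHaarLHSModel (Steering.wernerState d η)
        (fun b a ψ =>
          t * Steering.wernerResponse b a ψ + (1 - t) * Steering.bornResponse b a ψ)) ∧
      ¬ Steering.BellNonlocal.{u} (Steering.wernerState d η)) ∧
    -- at the threshold, the responses are exactly Werner's
    Steering.IsHaarLHSModel (Steering.wernerState d (1 - 1 / (d : ℝ)))
      (fun b a ψ => Steering.wernerResponse b a ψ) ∧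
    -- the bound for arbitrary responses to Haar-random pure states, attained by Werner's
    (∀ b : OrthonormalBasis (Fin d) ℂ (EuclideanSpace ℂ (Fin d)),
      (∀ p : Fin d → Steering.PureState d → ℝ,
        Steering.IsResponse (Steering.haarPure d) Finset.univ p →
        1 / (d : ℝ) ^ 3 ≤ (1 / (d : ℝ)) * ∑ a, Steering.expectation
          (Steering.ensembleAverage (Steering.haarPure d)
            (fun ψ => Steering.ketBra ψ.1) (p a)) (b a)) ∧
      (∀ a, Steering.expectation
          (Steering.ensembleAverage (Steering.haarPure d)
            (fun ψ => Steering.ketBra ψ.1) (Steering.wernerResponse b a)) (b a)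
        = 1 / (d : ℝ) ^ 3)) := by
  have hne : NeZero d := ⟨by omega⟩
  refine ⟨Steering.isDensityMatrix_wernerState_iff d hd, fun η _ => ⟨fun hs => ?_, fun hη => ?_⟩,
    fun η hρ hη => ?_, Steering.isHaarLHSModel_wernerResponse d hd,
    fun b => ⟨fun p hp => Steering.haar_response_bound d b hp,
      Steering.expectation_wernerResponse d b⟩⟩
  · obtain ⟨M, hM⟩ := hs
    by_contra! hη
    have hr := (Steering.isDensityMatrix_wernerState_iff d hd η).1 ‹_›
    obtain ⟨t, -, -, ht⟩ := Steering.exists_isHaarLHSModel d hd η hr.1 hη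
    exact hM ⟨_, _, _, _, (ht.isLHSEnsembleFor M).ulift⟩
  -- The averaging argument needs a single ensemble serving every basis at once, so the strategy
  -- consists of all observables.
  · refine ⟨Set.univ, ?_⟩
    rintro ⟨Ξ, _, μ, ρ, h⟩
    exact absurd (h.wernerState_le hd) (not_le.2 hη)
  · have hr := (Steering.isDensityMatrix_wernerState_iff d hd η).1 hρ
    obtain ⟨t, ht0, ht1, ht⟩ := Steering.exists_isHaarLHSModel d hd η hr.1 hη
    refine ⟨ht.isLHSEnsembleFor Set.univ, ⟨t, ht0, ht1, ht⟩, ?_⟩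
    rintro ⟨M, N, h⟩
    exact h ((ht.isLHSEnsembleFor M).ulift.hasLHVModel N)
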